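/- **Conventions.** Let $G=GL_2(\mathbb Z)\ltimes\mathbb Z^2$ act on $\mathbb R^2$ by $x\mapsto Ux+v$; a *$G$-map* is a map $\mathbb R^2\to\mathbb R^2$ induced by an element of $G$. A *polygon* is a nonempty finite union of nondegenerate closed triangles in $\mathbb R^2$ (not necessarily convex); its *vertices* are the boundary points near which its boundary is not a straight line. It has *denominator* $d$ if $d$ is the least positive integer such that all vertices of $dP$ are integral. For bounded $S\subset\mathbb R^2$ and $t\in\mathbb N$ let $\mathrm{ehr}_S(t)=|tS\cap\mathbb Z^2|$. A *rational open simplex* is a rational point, an open segment with distinct rational endpoints, or an open nondegenerate triangle with rational vertices. A *triangulation* $\mathcal T$ of $P$ is a finite collection of pairwise disjoint rational open simplices with union $P$; $\mathcal T^\Delta$ denotes the set of its open triangles (its open facets). A *facet map* $\mathcal F^\Delta:\mathcal T_1^\Delta\to\mathcal T_2^\Delta$ is a map on the union of the open facets of $\mathcal T_1$ that agrees with some $G$-map on each open facet of $\mathcal T_1$ and such that $A\mapsto\mathcal F^\Delta(A)$ is a bijection from $\mathcal T_1^\Delta$ to $\mathcal T_2^\Delta$. A *rational discrete equidecomposability relation*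 $\mathcal F:P\to Q$ is a map on $P$ for which there is a triangulation $\{S_1,\dots,S_r\}$ of $P$ such that $\mathcal F|_{S_i}$ agrees with a $G$-map for each $i$, and $Q=\bigsqcup_{i=1}^r\mathcal F(S_i)$ (disjoint union). Let $\mathcal L_d=\frac1d\mathbb Z\times\frac1d\mathbb Z$. A segment $E$ with distinct endpoints in $\mathcal L_d$ is *$d$-minimal* if $E\cap\mathcal L_d$ consists exactly of its endpoints. If the endpoints of $E$ are $(\frac wd,\frac xd)$ and $(\frac yd,\frac zd)$, put $i=wz-xy \bmod d$; the *Weight* $\mathbf W_d(E)$ is the pair consisting of $\pm i$ (the set $\{i,-i\}\subset\mathbb Z/d\mathbb Z$) and the $G$-equivalence class of $E$. For a polygon $P$ of denominator $d$, $\mathbf W_d(P)$ is the multiset of the Weights $\mathbf W_d(E)$ of the $d$-minimal segments $E$ contained in the boundary of $P$. **Proposition.** Let $P$ and $Q$ be polygons of denominator $d$ with triangulations $\mathcal T_1$ and $\mathcal T_2$, respectively, and let $\mathcal F^\Delta:\mathcal T_1^\Delta\to\mathcal T_2^\Delta$ be a facet map. Then there exists a rational discrete equidecomposability relation $\mathcal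 F:P\to Q$ if and only if 1. $\mathrm{ehr}_P=\mathrm{ehr}_Q$, and 2. $\mathbf W_d(P)=\mathbf W_d(Q)$. Moreover, (1) and (2) hold if and only if there exists a rational discrete equidecomposability relation $\mathcal F:P\to Q$ that extends $\mathcal F^\Delta$, i.e. agrees with $\mathcal F^\Delta$ on every open facet of $\mathcal T_1$. -/

import Mathlib

open scoped Matrix Pointwise Topology

noncomputable section

namespace DiscreteEquidecomposability

/-- The plane `ℝ²`. Only its topology and its real affine structure are used. -/
abbrev Plane : Type := Fin 2 → ℝ

/-! ### The affine unimodular group -/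

/-- The action `x ↦ U x + v` of the element `(U, v)` of `GL₂(ℤ) ⋊ ℤ²` on the plane. -/
def affineUnimodular (U : GL (Fin 2) ℤ) (v : Fin 2 → ℤ) (x : Plane) : Plane :=
  ((U : Matrix (Fin 2) (Fin 2) ℤ).map (Int.cast : ℤ → ℝ)) *ᵥ x + fun i => (v i : ℝ)

/-- A `G`-map: a transformation of the plane induced by an element of `G = GL₂(ℤ) ⋊ ℤ²`. -/
def IsGMap (g : Plane → Plane) : Prop :=
  ∃ (U : GL (Fin 2) ℤ) (v : Fin 2 → ℤ), g = affineUnimodular U v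

/-! ### Lattices and the Ehrhart function -/

/-- The point `(a₀ / d, a₁ / d)`. -/
def latticePoint (d : ℕ) (a : Fin 2 → ℤ) : Plane := fun i => (a i : ℝ) / (d : ℝ)

/-- The lattice `𝓛_d = (1/d)ℤ × (1/d)ℤ`. -/
def lattice (d : ℕ) : Set Plane := Set.range (latticePoint d)

/-- The Ehrhart function `t ↦ |t S ∩ ℤ²|` of a bounded subset `S` of the plane. -/
def ehr (S : Set Plane) (t : ℕ) : ℕ := (((t : ℝ) • S) ∩ lattice 1).ncard

/-! ### Polygons -/

/-- A polygon, not necessarily convex: a nonempty finite union of nondegenerate closed triangles. -/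
def IsPolygon (P : Set Plane) : Prop :=
  ∃ (n : ℕ) (t : Fin n → Fin 3 → Plane), 0 < n ∧ (∀ i, AffineIndependent ℝ (t i)) ∧
    P = ⋃ i, convexHull ℝ (Set.range (t i))

/-- A vertex of a polygon: a boundary point near which the boundary is not a straight line. -/
def IsVertex (P : Set Plane) (v : Plane) : Prop :=
  v ∈ frontier P ∧
    ¬ ∃ U ∈ 𝓝 v, ∃ u : Plane, u ≠ 0 ∧ frontier P ∩ U = {x | ∃ s : ℝ, x = v + s • u} ∩ U

/-- `P` has denominator `d`: `d` is the least positive integer such that all vertices of `d P` are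
integral, that is, all vertices of `P` lie in `𝓛_d`. -/
def HasDenominator (P : Set Plane) (d : ℕ) : Prop :=
  IsLeast {k : ℕ | 0 < k ∧ ∀ v, IsVertex P v → v ∈ lattice k} d

/-! ### Simplices and triangulations -/

/-- The open simplex spanned by the points `p i`: all convex combinations with positive weights. -/
def openSimplex {k : ℕ} (p : Fin (k + 1) → Plane) : Set Plane :=
  {x | ∃ w : Fin (k + 1) → ℝ, (∀ i, 0 < w i) ∧ ∑ i, w i = 1 ∧ x = ∑ i, w i • p i}

/-- A rational open `k`-simplex: a rational point (`k = 0`), an open segment (`k = 1`) or an open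
triangle (`k = 2`) with rational vertices. -/
def IsRationalOpenSimplex (k : ℕ) (S : Set Plane) : Prop :=
  ∃ p : Fin (k + 1) → Plane, AffineIndependent ℝ p ∧ (∀ i j, ∃ q : ℚ, p i j = (q : ℝ)) ∧
    S = openSimplex p

/-- A (rational) triangulation of `P`, given by its open simplices (vertices, open edges and open
facets): finitely many pairwise disjoint rational open simplices with union `P`. -/
structure IsTriangulation (T : Set (Set Plane)) (P : Set Plane) : Prop where
  finite : T.Finite
  simplex : ∀ S ∈ T, ∃ k ≤ 2, IsRationalOpenSimplex k S
  disjoint : T.PairwiseDisjoint id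
  union : ⋃₀ T = P

/-- The set `T^Δ` of open facets of `T`. -/
def facets (T : Set (Set Plane)) : Set (Set Plane) := {S ∈ T | IsRationalOpenSimplex 2 S}

/-! ### Facet maps and equidecomposability relations -/

/-- `f`, of which only the restriction to the union of the open facets of `T₁` matters, is a facet
map from `T₁` to `T₂`: it restricts to a `G`-map on each open facet of `T₁`, and it induces a
bijection from the open facets of `T₁` to those of `T₂`. -/
structure IsFacetMap (T₁ T₂ : Set (Set Plane)) (f : Plane → Plane) : Prop where
  bijOn : Set.BijOn (fun S => f '' S) (facets T₁) (facets T₂)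
  gMap : ∀ S ∈ facets T₁, ∃ g, IsGMap g ∧ Set.EqOn f g S

/-- `F`, of which only the restriction to `P` matters, is a (finite, rational) discrete
equidecomposability relation from `P` to `Q`: `P` is a disjoint union of finitely many rational
open simplices, `F` restricts to a `G`-map on each of them, and `Q` is the disjoint union of their
images. -/
def IsEquidecomposabilityRelation (P Q : Set Plane) (F : Plane → Plane) : Prop :=
  ∃ T : Set (Set Plane), IsTriangulation T P ∧ (∀ S ∈ T, ∃ g, IsGMap g ∧ Set.EqOn F g S) ∧
    T.PairwiseDisjoint (fun S => F '' S) ∧ ⋃ S ∈ T, F '' S = Q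

/-! ### Weights -/

/-- A `d`-minimal segment: a segment that meets `𝓛_d` precisely in its (distinct) endpoints. -/
def IsMinimalSegment (d : ℕ) (E : Set Plane) : Prop :=
  ∃ p q : Plane, p ≠ q ∧ E = segment ℝ p q ∧ E ∩ lattice d = {p, q}

/-- The weight of the oriented segment from `(a₀/d, a₁/d)` to `(b₀/d, b₁/d)`. -/
def orientedWeight (d : ℕ) (a b : Fin 2 → ℤ) : ZMod d :=
  ((!![a 0, b 0; a 1, b 1] : Matrix (Fin 2) (Fin 2) ℤ).det : ZMod d)

/-- The Weight `(± i, j)` of a `d`-minimal segment `E`. The first entry is the set `{i, -i}` of the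
weights of `E` for its two orientations; the second entry labels the `G`-equivalence class of `E`
by the class itself. -/
def segmentWeight (d : ℕ) (E : Set Plane) : Set (ZMod d) × Set (Set Plane) :=
  ({w | ∃ a b : Fin 2 → ℤ, E = segment ℝ (latticePoint d a) (latticePoint d b) ∧
      w = orientedWeight d a b},
    {E' | ∃ g, IsGMap g ∧ E' = g '' E})

/-- The `d`-minimal segments on the boundary of `P`. -/
def boundarySegments (d : ℕ) (P : Set Plane) : Set (Set Plane) :=
  {E | IsMinimalSegment d E ∧ E ⊆ frontier P}

theorem IsPolygon.isCompact {P : Set Plane} (hP : IsPolygon P) : IsCompact P := by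
  obtain ⟨n, t, -, -, rfl⟩ := hP
  exact isCompact_iUnion fun i => (Set.finite_range (t i)).isCompact_convexHull ℝ

theorem finite_lattice_inter {d : ℕ} (hd : 0 < d) {K : Set Plane} (hK : IsCompact K) :
    (K ∩ lattice d).Finite := by
  obtain ⟨R, hR⟩ := hK.isBounded.exists_norm_le
  have hd' : (0 : ℝ) < d := by exact_mod_cast hd
  have hfin : (Set.pi Set.univ fun _ : Fin 2 => Set.Icc (-⌈R * d⌉) ⌈R * d⌉).Finite :=
    Set.Finite.pi fun _ => Set.finite_Icc _ _
  refine (hfin.image (latticePoint d)).subset ?_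
  rintro _ ⟨hx, a, rfl⟩
  refine ⟨a, fun i _ => ?_, rfl⟩
  have h1 : |(a i : ℝ) / d| ≤ R := (norm_le_pi_norm (latticePoint d a) i).trans (hR _ hx)
  rw [abs_div, abs_of_pos hd', div_le_iff₀ hd', abs_le] at h1
  have h2 := Int.le_ceil (R * d)
  constructor
  · have : ((-⌈R * d⌉ : ℤ) : ℝ) ≤ a i := by push_cast; linarith
    exact_mod_cast this
  · have : (a i : ℝ) ≤ (⌈R * d⌉ : ℤ) := by linarith
    exact_mod_cast this

/-- The boundary of a polygon contains only finitely many `d`-minimal segments. -/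
theorem IsPolygon.finite_boundarySegments {P : Set Plane} (hP : IsPolygon P) {d : ℕ}
    (hd : 0 < d) : (boundarySegments d P).Finite := by
  have h := finite_lattice_inter hd hP.isCompact
  refine ((h.prod h).image fun x => segment ℝ x.1 x.2).subset ?_
  rintro E ⟨⟨p, q, -, rfl, hE⟩, hfr⟩
  have hsub : segment ℝ p q ∩ lattice d ⊆ P ∩ lattice d :=
    Set.inter_subset_inter_left _ (hfr.trans hP.isCompact.isClosed.frontier_subset)
  rw [hE] at hsub
  exact ⟨(p, q), ⟨hsub (by simp), hsub (by simp)⟩, rfl⟩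

/-- The Weight of `P`: the multiset of the Weights of the `d`-minimal segments that make up the
boundary of `P`. For a polygon and `0 < d` the sum is finite, by
`IsPolygon.finite_boundarySegments`. -/
def polygonWeight (d : ℕ) (P : Set Plane) : Multiset (Set (ZMod d) × Set (Set Plane)) :=
  ∑ᶠ E ∈ boundarySegments d P, {segmentWeight d E}

theorem IsPolygon.polygonWeight_eq {P : Set Plane} (hP : IsPolygon P) {d : ℕ} (hd : 0 < d) :
    polygonWeight d P =
      (hP.finite_boundarySegments hd).toFinset.val.map (segmentWeight d) := by
  rw [polygonWeight, finsum_mem_eq_finite_toFinset_sum _ (hP.finite_boundarySegments hd),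
    Finset.sum,
    ← Multiset.sum_map_singleton (Multiset.map (segmentWeight d) _), Multiset.map_map]
  rfl

end DiscreteEquidecomposability

end

open DiscreteEquidecomposability

open scoped Matrix Pointwise Topology

noncomputable section

namespace DiscreteEquidecomposability

/-! ### `G`-maps -/

/-! Everything is reduced to counting points of `G`-orbits. Write `R_P` for `P` minus the open
facets of its triangulation, a finite union of rational points and open segments. Two kinds of
orbits matter: those of rational points, and those of generic points, which lie at an irrational
position on a rational line. Exactly one rational line passes through a generic point, so near it
every rational triangle with that point on its boundary is a half-plane.

Boundary. A generic point of `R_P` lies on the boundary of two facets, or of one if it is on `∂P`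
(`IsTriangulation.ncard_facets_frontier`). Summing over an orbit `O` gives `∑ |O ∩ ∂S| + |O ∩ ∂P| =
2 |O ∩ R_P|`. A facet map matches the facet sums, so `|O ∩ ∂P| - |O ∩ ∂Q| = 2 (|O ∩ R_P| - |O ∩
R_Q|)` (`IsFacetMap.ncard_frontier_add`). Equality of Weights says exactly that the left side is
always zero (`polygonWeight_eq_iff`): a `G`-map taking a generic point of one `d`-minimal segment
into another takes the one segment onto the other.

Necessity. A relation preserves Ehrhart counts piece by piece. It is itself a facet map onto the
image triangulation and preserves orbit counts on `R_P`, so the boundary counts agree.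

Sufficiency. Equal Weights give equal generic counts on `R_P` and `R_Q`. The orbit of a rational
point is the set of points of the same denominator, so the Ehrhart function determines its counts on
`P` and `Q`; subtracting the facets, where the facet map preserves counts, gives `R_P` and `R_Q`.
Finally `R_P` and `R_Q` are cut into cells of one common lattice. Orbit counts determine how many
cells each `G`-class has, so the cells can be matched by `G`-maps and glued to the facet map
(`IsFacetMap.exists_extension`). -/

theorem affineUnimodular_apply (U : GL (Fin 2) ℤ) (v : Fin 2 → ℤ) (x : Plane) (i : Fin 2) :
    affineUnimodular U v x i = (U.1 i 0 : ℝ) * x 0 + (U.1 i 1 : ℝ) * x 1 + v i := by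
  fin_cases i <;> simp [affineUnimodular]

theorem affineUnimodular_affineUnimodular (U U' : GL (Fin 2) ℤ) (v v' : Fin 2 → ℤ) (x : Plane) :
    affineUnimodular U v (affineUnimodular U' v' x) =
      affineUnimodular (U * U') (U.1 *ᵥ v' + v) x := by
  ext i
  simp only [affineUnimodular_apply, Units.val_mul, Matrix.mul_apply, Matrix.mulVec, dotProduct,
    Fin.sum_univ_two, Pi.add_apply, Int.cast_add, Int.cast_mul]
  ring

theorem affineUnimodular_one_zero : affineUnimodular 1 0 = id := by
  ext x i
  fin_cases i <;> simp [affineUnimodular_apply]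

theorem isGMap_id : IsGMap id := ⟨1, 0, affineUnimodular_one_zero.symm⟩

theorem IsGMap.comp {g h : Plane → Plane} (hg : IsGMap g) (hh : IsGMap h) : IsGMap (g ∘ h) := by
  obtain ⟨U, v, rfl⟩ := hg
  obtain ⟨U', v', rfl⟩ := hh
  exact ⟨U * U', _, funext fun x => affineUnimodular_affineUnimodular U U' v v' x⟩

/-- A `G`-map is an affine equivalence whose inverse is a `G`-map. -/
theorem IsGMap.exists_affineEquiv {g : Plane → Plane} (hg : IsGMap g) :
    ∃ e : Plane ≃ᵃ[ℝ] Plane, g = e ∧ IsGMap e.symm := by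
  obtain ⟨U, v, rfl⟩ := hg
  let L : Plane →ₗ[ℝ] Plane :=
    Matrix.toLin' ((U : Matrix (Fin 2) (Fin 2) ℤ).map (Int.cast : ℤ → ℝ))
  let w : Fin 2 → ℤ := -(U⁻¹.1 *ᵥ v)
  have h1 : ∀ x, affineUnimodular U⁻¹ w (affineUnimodular U v x) = x := fun x => by
    rw [affineUnimodular_affineUnimodular, inv_mul_cancel, add_neg_cancel,
      affineUnimodular_one_zero, id]
  have h2 : ∀ x, affineUnimodular U v (affineUnimodular U⁻¹ w x) = x := fun x => by
    rw [affineUnimodular_affineUnimodular, mul_inv_cancel, Matrix.mulVec_neg,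
      Matrix.mulVec_mulVec, ← Units.val_mul, mul_inv_cancel, Units.val_one, Matrix.one_mulVec,
      neg_add_cancel, affineUnimodular_one_zero, id]
  let A : Plane →ᵃ[ℝ] Plane :=
    { toFun := affineUnimodular U v
      linear := L
      map_vadd' := fun p u => by
        simp [affineUnimodular, L, Matrix.mulVec_add, add_assoc] }
  let e : Plane ≃ᵃ[ℝ] Plane :=
    AffineEquiv.ofBijective (φ := A) ⟨Function.LeftInverse.injective h1,
      Function.RightInverse.surjective h2⟩
  refine ⟨e, rfl, U⁻¹, w, funext fun x => ?_⟩
  have : affineUnimodular U v (e.symm x) = x := e.apply_symm_apply x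
  rw [← h1 (e.symm x), this]

theorem IsGMap.injective {g : Plane → Plane} (hg : IsGMap g) : Function.Injective g := by
  obtain ⟨e, rfl, -⟩ := hg.exists_affineEquiv
  exact e.injective

/-! ### Invariant sets, orbits and equivalence under `G`. -/

/-- A set that is stable under all `G`-maps. -/
def IsGInvariant (A : Set Plane) : Prop := ∀ g, IsGMap g → ∀ x, x ∈ A → g x ∈ A

theorem IsGInvariant.apply_mem_iff {A : Set Plane} (hA : IsGInvariant A) {g : Plane → Plane}
    (hg : IsGMap g) {x : Plane} : g x ∈ A ↔ x ∈ A := by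
  refine ⟨fun h => ?_, hA g hg x⟩
  obtain ⟨e, rfl, he⟩ := hg.exists_affineEquiv
  simpa using hA _ he _ h

/-- Integral translations move numerators by multiples of `d`, which is why the weight is a residue
modulo `d`. -/
theorem affineUnimodular_latticePoint {d : ℕ} (hd : 0 < d) (U : GL (Fin 2) ℤ) (v a : Fin 2 → ℤ) :
    affineUnimodular U v (latticePoint d a) = latticePoint d (U.1 *ᵥ a + (d : ℤ) • v) := by
  ext i
  have hd' : (d : ℝ) ≠ 0 := by positivity
  rw [affineUnimodular_apply]
  simp only [latticePoint, Matrix.mulVec, dotProduct, Fin.sum_univ_two, Pi.add_apply,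
    Pi.smul_apply, smul_eq_mul]
  push_cast
  field_simp

theorem isGInvariant_lattice {d : ℕ} (hd : 0 < d) : IsGInvariant (lattice d) := by
  rintro _ ⟨U, v, rfl⟩ _ ⟨a, rfl⟩
  exact ⟨_, (affineUnimodular_latticePoint hd U v a).symm⟩

/-- A point with rational coordinates. -/
def IsRationalPoint (x : Plane) : Prop := ∀ i, ∃ q : ℚ, x i = (q : ℝ)

theorem isGInvariant_isRationalPoint : IsGInvariant {x | IsRationalPoint x} := by
  rintro _ ⟨U, v, rfl⟩ x hx i
  obtain ⟨q, hq⟩ := hx 0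
  obtain ⟨r, hr⟩ := hx 1
  exact ⟨U.1 i 0 * q + U.1 i 1 * r + v i, by rw [affineUnimodular_apply, hq, hr]; push_cast; rfl⟩

theorem isRationalPoint_of_mem_lattice {d : ℕ} {x : Plane} (hx : x ∈ lattice d) :
    IsRationalPoint x := by
  obtain ⟨a, rfl⟩ := hx
  exact fun i => ⟨a i / d, by simp [latticePoint]⟩

/-- The orbit of a point under `G`. -/
def gOrbit (x : Plane) : Set Plane := {y | ∃ g, IsGMap g ∧ y = g x}

theorem isGInvariant_gOrbit (x : Plane) : IsGInvariant (gOrbit x) := by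
  rintro g hg _ ⟨h, hh, rfl⟩
  exact ⟨_, hg.comp hh, rfl⟩

theorem mem_gOrbit_self (x : Plane) : x ∈ gOrbit x := ⟨id, isGMap_id, rfl⟩

theorem IsGInvariant.gOrbit_subset {A : Set Plane} (hA : IsGInvariant A) {x : Plane}
    (hx : x ∈ A) : gOrbit x ⊆ A := by
  rintro _ ⟨g, hg, rfl⟩
  exact hA g hg x hx

theorem mem_gOrbit_symm {x y : Plane} (h : y ∈ gOrbit x) : x ∈ gOrbit y := by
  obtain ⟨g, hg, rfl⟩ := h
  exact ((isGInvariant_gOrbit (g x)).apply_mem_iff hg).1 (mem_gOrbit_self _)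

theorem gOrbit_eq {x y : Plane} (h : y ∈ gOrbit x) : gOrbit y = gOrbit x :=
  ((isGInvariant_gOrbit x).gOrbit_subset h).antisymm
    ((isGInvariant_gOrbit y).gOrbit_subset (mem_gOrbit_symm h))

/-- `G`-equivalence of subsets of the plane. -/
def GEquivalent (S S' : Set Plane) : Prop := ∃ g, IsGMap g ∧ S' = g '' S

theorem GEquivalent.refl (S : Set Plane) : GEquivalent S S := ⟨id, isGMap_id, by simp⟩

theorem GEquivalent.symm {S S' : Set Plane} (h : GEquivalent S S') : GEquivalent S' S := by
  obtain ⟨g, hg, rfl⟩ := h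
  obtain ⟨e, rfl, he⟩ := hg.exists_affineEquiv
  exact ⟨_, he, by simp [Set.image_image]⟩

theorem GEquivalent.trans {S S' S'' : Set Plane} (h : GEquivalent S S') (h' : GEquivalent S' S'') :
    GEquivalent S S'' := by
  obtain ⟨g, hg, rfl⟩ := h
  obtain ⟨g', hg', rfl⟩ := h'
  exact ⟨_, hg'.comp hg, by simp [Set.image_image]⟩

theorem IsGInvariant.inter_image {A : Set Plane} (hA : IsGInvariant A) {g : Plane → Plane}
    (hg : IsGMap g) (S : Set Plane) : A ∩ g '' S = g '' (A ∩ S) := by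
  ext y
  constructor
  · rintro ⟨hy, x, hx, rfl⟩
    exact ⟨x, ⟨(hA.apply_mem_iff hg).1 hy, hx⟩, rfl⟩
  · rintro ⟨x, ⟨h1, h2⟩, rfl⟩
    exact ⟨hA g hg x h1, x, h2, rfl⟩

theorem GEquivalent.ncard_inter {A S S' : Set Plane} (h : GEquivalent S S')
    (hA : IsGInvariant A) : (A ∩ S').ncard = (A ∩ S).ncard := by
  obtain ⟨g, hg, rfl⟩ := h
  rw [hA.inter_image hg, Set.ncard_image_of_injective _ hg.injective]

theorem IsGMap.frontier_image {g : Plane → Plane} (hg : IsGMap g) (S : Set Plane) :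
    frontier (g '' S) = g '' frontier S := by
  obtain ⟨e, rfl, -⟩ := hg.exists_affineEquiv
  exact ((AffineEquiv.toContinuousAffineEquiv e).toHomeomorph.image_frontier S).symm

theorem GEquivalent.frontier {S S' : Set Plane} (h : GEquivalent S S') :
    GEquivalent (frontier S) (frontier S') := by
  obtain ⟨g, hg, rfl⟩ := h
  exact ⟨g, hg, hg.frontier_image S⟩

theorem IsGMap.image_openSimplex {g : Plane → Plane} (hg : IsGMap g) {k : ℕ}
    (p : Fin (k + 1) → Plane) : g '' openSimplex p = openSimplex (g ∘ p) := by
  obtain ⟨e, rfl, -⟩ := hg.exists_affineEquiv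
  have key : ∀ w : Fin (k + 1) → ℝ, ∑ i, w i = 1 → e (∑ i, w i • p i) = ∑ i, w i • e (p i) := by
    intro w hw
    have := Finset.univ.map_affineCombination p w hw (e : Plane →ᵃ[ℝ] Plane)
    rwa [Finset.affineCombination_eq_linear_combination _ _ _ hw,
      Finset.affineCombination_eq_linear_combination _ _ _ hw] at this
  ext y
  constructor
  · rintro ⟨_, ⟨w, hw, h1, rfl⟩, rfl⟩
    exact ⟨w, hw, h1, key w h1⟩
  · rintro ⟨w, hw, h1, rfl⟩
    exact ⟨_, ⟨w, hw, h1, rfl⟩, key w h1⟩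

theorem IsGMap.isRationalOpenSimplex_image {g : Plane → Plane} (hg : IsGMap g) {k : ℕ}
    {S : Set Plane} (hS : IsRationalOpenSimplex k S) : IsRationalOpenSimplex k (g '' S) := by
  obtain ⟨p, hp, hr, rfl⟩ := hS
  refine ⟨g ∘ p, ?_, fun i => isGInvariant_isRationalPoint g hg _ (hr i),
    hg.image_openSimplex p⟩
  obtain ⟨e, rfl, -⟩ := hg.exists_affineEquiv
  exact hp.map' (e : Plane →ᵃ[ℝ] Plane) e.injective

theorem GEquivalent.isRationalOpenSimplex {S S' : Set Plane} (h : GEquivalent S S') {k : ℕ}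
    (hS : IsRationalOpenSimplex k S) : IsRationalOpenSimplex k S' := by
  obtain ⟨g, hg, rfl⟩ := h
  exact hg.isRationalOpenSimplex_image hS

theorem openSimplex_nonempty {k : ℕ} (p : Fin (k + 1) → Plane) : (openSimplex p).Nonempty :=
  ⟨_, fun _ => 1 / (k + 1 : ℝ), fun _ => by positivity, by simp; field_simp, rfl⟩

theorem IsRationalOpenSimplex.nonempty {k : ℕ} {S : Set Plane} (h : IsRationalOpenSimplex k S) :
    S.Nonempty := by
  obtain ⟨p, -, -, rfl⟩ := h
  exact openSimplex_nonempty p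

/-! ### Maps that are piecewise `G`-maps -/

/-- `f` restricts to a `G`-map on each member of `T`, and the images are pairwise disjoint. -/
structure IsPiecewiseGMap (T : Set (Set Plane)) (f : Plane → Plane) : Prop where
  gMap : ∀ S ∈ T, ∃ g, IsGMap g ∧ Set.EqOn f g S
  disjoint : T.PairwiseDisjoint (fun S => f '' S)

variable {T : Set (Set Plane)} {f : Plane → Plane}

theorem IsPiecewiseGMap.mono (h : IsPiecewiseGMap T f) {T' : Set (Set Plane)} (hT : T' ⊆ T) :
    IsPiecewiseGMap T' f :=
  ⟨fun S hS => h.gMap S (hT hS), h.disjoint.subset hT⟩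

theorem IsPiecewiseGMap.gEquivalent (h : IsPiecewiseGMap T f) {S : Set Plane} (hS : S ∈ T) :
    GEquivalent S (f '' S) := by
  obtain ⟨g, hg, he⟩ := h.gMap S hS
  exact ⟨g, hg, he.image_eq⟩

theorem IsPiecewiseGMap.injOn (h : IsPiecewiseGMap T f) : Set.InjOn f (⋃₀ T) := by
  rintro x ⟨S, hS, hx⟩ y ⟨S', hS', hy⟩ hxy
  obtain rfl : S = S' := by
    by_contra hne
    exact Set.disjoint_left.1 (h.disjoint hS hS' hne) ⟨x, hx, rfl⟩ ⟨y, hy, hxy.symm⟩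
  obtain ⟨g, hg, he⟩ := h.gMap S hS
  exact hg.injective (by rw [← he hx, ← he hy, hxy])

/-- The source of all invariants: lattices give the Ehrhart function, orbits give the finer counts.
No finiteness is needed, since an injective image has the same `ncard` even when infinite. -/
theorem IsPiecewiseGMap.ncard_inter (h : IsPiecewiseGMap T f) {A : Set Plane}
    (hA : IsGInvariant A) : (A ∩ ⋃ S ∈ T, f '' S).ncard = (A ∩ ⋃₀ T).ncard := by
  rw [← (h.injOn.mono Set.inter_subset_right).ncard_image]
  congr 1
  have key : ∀ S ∈ T, ∀ x ∈ S, (f x ∈ A ↔ x ∈ A) := by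
    intro S hS x hx
    obtain ⟨g, hg, he⟩ := h.gMap S hS
    rw [he hx, hA.apply_mem_iff hg]
  ext y
  simp only [Set.mem_inter_iff, Set.mem_iUnion, Set.mem_image, Set.mem_sUnion]
  constructor
  · rintro ⟨hy, S, hS, x, hx, rfl⟩
    exact ⟨x, ⟨(key S hS x hx).1 hy, S, hS, hx⟩, rfl⟩
  · rintro ⟨x, ⟨hxA, S, hS, hx⟩, rfl⟩
    exact ⟨(key S hS x hx).2 hxA, S, hS, x, hx, rfl⟩

theorem IsFacetMap.isPiecewiseGMap {T₁ T₂ : Set (Set Plane)} (h : IsFacetMap T₁ T₂ f)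
    (hT₂ : T₂.PairwiseDisjoint id) : IsPiecewiseGMap (facets T₁) f := by
  refine ⟨h.gMap, fun S hS S' hS' hne => ?_⟩
  exact hT₂ (h.bijOn.mapsTo hS).1 (h.bijOn.mapsTo hS').1 fun he => hne (h.bijOn.injOn hS hS' he)

theorem IsFacetMap.biUnion_image {T₁ T₂ : Set (Set Plane)} (h : IsFacetMap T₁ T₂ f) :
    ⋃ S ∈ facets T₁, f '' S = ⋃₀ facets T₂ := by
  rw [← h.bijOn.image_eq, Set.sUnion_image]

/-! ### Rational affine forms and generic points -/

/-- The affine form `x ↦ c₀ x₀ + c₁ x₁ + c₂` with rational coefficients. -/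
def rationalForm (c : Fin 3 → ℚ) (x : Plane) : ℝ := c 0 * x 0 + c 1 * x 1 + c 2

/-- The linear part of `rationalForm c`. -/
def rationalForm.linear (c : Fin 3 → ℚ) (u : Plane) : ℝ := c 0 * u 0 + c 1 * u 1

theorem continuous_rationalForm (c : Fin 3 → ℚ) : Continuous (rationalForm c) := by
  unfold rationalForm; fun_prop

theorem rationalForm_add_smul (c : Fin 3 → ℚ) (x u : Plane) (s : ℝ) :
    rationalForm c (x + s • u) = rationalForm c x + s * rationalForm.linear c u := by
  simp [rationalForm, rationalForm.linear]; ring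

theorem rationalForm.linear_neg (c : Fin 3 → ℚ) (u : Plane) :
    rationalForm.linear c (-u) = -rationalForm.linear c u := by
  simp [rationalForm.linear]; ring

theorem IsRationalPoint.rationalForm {x : Plane} (hx : IsRationalPoint x) (c : Fin 3 → ℚ) :
    ∃ q : ℚ, rationalForm c x = q := by
  obtain ⟨q, hq⟩ := hx 0
  obtain ⟨r, hr⟩ := hx 1
  exact ⟨c 0 * q + c 1 * r + c 2, by simp [DiscreteEquidecomposability.rationalForm, hq, hr]⟩

/-- `x` lies on the line through the rational points `a ≠ b`, at an irrational position. -/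
structure IsGenericOn (a b x : Plane) : Prop where
  left : IsRationalPoint a
  right : IsRationalPoint b
  ne : a ≠ b
  exists_irrational : ∃ t, Irrational t ∧ x = a + t • (b - a)

/-- A generic point of a rational line. -/
def IsGeneric (x : Plane) : Prop := ∃ a b, IsGenericOn a b x

theorem rationalForm_line (c : Fin 3 → ℚ) (a b : Plane) (t : ℝ) :
    rationalForm c (a + t • (b - a)) =
      rationalForm c a + t * (rationalForm c b - rationalForm c a) := by
  simp [rationalForm]; ring

/-- Along the line the form is an affine function of the parameter with rational coefficients; a
nonzero one has no irrational root. -/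
theorem IsGenericOn.rationalForm_eq_zero {a b x : Plane} (h : IsGenericOn a b x) {c : Fin 3 → ℚ}
    (hc : rationalForm c x = 0) : rationalForm c a = 0 ∧ rationalForm c b = 0 := by
  obtain ⟨t, ht, rfl⟩ := h.exists_irrational
  obtain ⟨q, hq⟩ := h.left.rationalForm c
  obtain ⟨r, hr⟩ := h.right.rationalForm c
  rw [rationalForm_line, hq, hr] at hc
  rw [hq, hr]
  have h1 : (r : ℝ) - q = 0 := by
    by_contra hne
    refine ht ⟨-q / (r - q), ?_⟩
    push_cast
    field_simp
    linarith
  rw [h1] at hc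
  exact ⟨by linarith, by linarith⟩

theorem IsGeneric.not_isRationalPoint {x : Plane} (h : IsGeneric x) : ¬ IsRationalPoint x := by
  obtain ⟨a, b, h⟩ := h
  intro hx
  refine h.ne (funext fun i => ?_)
  obtain ⟨q, hq⟩ := hx i
  fin_cases i
  -- The form `x 0 - q` vanishes at the point, hence at `a` and `b`, which therefore agree in this
  -- coordinate.
  · obtain ⟨h1, h2⟩ := h.rationalForm_eq_zero (c := ![1, 0, -q])
      (by simp [rationalForm]; linarith [show x 0 = q from hq])
    simp [rationalForm] at h1 h2
    show a 0 = b 0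
    linarith
  · obtain ⟨h1, h2⟩ := h.rationalForm_eq_zero (c := ![0, 1, -q])
      (by simp [rationalForm]; linarith [show x 1 = q from hq])
    simp [rationalForm] at h1 h2
    show a 1 = b 1
    linarith

theorem isGInvariant_isGeneric : IsGInvariant {x | IsGeneric x} := by
  rintro g hg _ ⟨a, b, ha, hb, hne, t, ht, rfl⟩
  refine ⟨g a, g b, isGInvariant_isRationalPoint g hg a ha, isGInvariant_isRationalPoint g hg b hb,
    fun h => hne (hg.injective h), t, ht, ?_⟩
  obtain ⟨e, rfl, -⟩ := hg.exists_affineEquiv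
  have := (e : Plane →ᵃ[ℝ] Plane).apply_lineMap a b t
  simp only [AffineMap.lineMap_apply_module', AffineEquiv.coe_toAffineMap] at this
  rw [add_comm, this, add_comm]

/-! ### Directions transverse to a rational line. -/

/-- The direction `m` leaves every rational line through `x`. -/
def IsTransverse (x m : Plane) : Prop :=
  ∀ y, ∃ s : ℝ, ∀ c, rationalForm c x = 0 → rationalForm c y = s * rationalForm.linear c m

theorem IsTransverse.neg {x m : Plane} (h : IsTransverse x m) : IsTransverse x (-m) := fun y => by
  obtain ⟨s, hs⟩ := h y
  exact ⟨-s, fun c hc => by rw [hs c hc, rationalForm.linear_neg]; ring⟩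

theorem IsGeneric.exists_isTransverse {x : Plane} (h : IsGeneric x) : ∃ m, IsTransverse x m := by
  obtain ⟨a, b, h⟩ := h
  -- `m` is normal to the line. A form vanishing at `x` vanishes on the whole line, so it sees only
  -- the normal coordinate `s` of `y - x`; hence one `s` serves all forms.
  refine ⟨![-(b 1 - a 1), b 0 - a 0], fun y => ?_⟩
  have hN : (b 0 - a 0) ^ 2 + (b 1 - a 1) ^ 2 ≠ 0 := by
    intro h0
    refine h.ne (funext fun i => ?_)
    fin_cases i
    · show a 0 = b 0
      nlinarith [sq_nonneg (b 0 - a 0), sq_nonneg (b 1 - a 1)]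
    · show a 1 = b 1
      nlinarith [sq_nonneg (b 0 - a 0), sq_nonneg (b 1 - a 1)]
  refine ⟨(-(b 1 - a 1) * (y 0 - x 0) + (b 0 - a 0) * (y 1 - x 1)) /
    ((b 0 - a 0) ^ 2 + (b 1 - a 1) ^ 2), fun c hc => ?_⟩
  obtain ⟨h1, h2⟩ := h.rationalForm_eq_zero hc
  rw [div_mul_eq_mul_div, eq_div_iff hN]
  simp only [rationalForm, rationalForm.linear, Matrix.cons_val_zero, Matrix.cons_val_one] at *
  have h3 : (c 0 : ℝ) * (b 0 - a 0) + c 1 * (b 1 - a 1) = 0 := by linarith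
  have h4 : (c 0 : ℝ) * y 0 + c 1 * y 1 + c 2 = c 0 * (y 0 - x 0) + c 1 * (y 1 - x 1) := by
    linarith
  rw [h4]
  linear_combination ((y 0 - x 0) * (b 0 - a 0) + (y 1 - x 1) * (b 1 - a 1)) * h3

theorem rationalForm_add_smul_gradient (c : Fin 3 → ℚ) (x : Plane) (s : ℝ) :
    rationalForm c (x + s • ![(c 0 : ℝ), (c 1 : ℝ)]) =
      rationalForm c x + s * ((c 0 : ℝ) ^ 2 + (c 1 : ℝ) ^ 2) := by
  rw [rationalForm_add_smul]
  simp only [rationalForm.linear, Matrix.cons_val_zero, Matrix.cons_val_one]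
  ring

/-- A rational affine form that is not constant. -/
def IsNonconstant (c : Fin 3 → ℚ) : Prop := c 0 ≠ 0 ∨ c 1 ≠ 0

theorem IsNonconstant.sq_pos {c : Fin 3 → ℚ} (hc : IsNonconstant c) :
    0 < (c 0 : ℝ) ^ 2 + (c 1 : ℝ) ^ 2 := by
  rcases hc with h | h
  · have : (c 0 : ℝ) ≠ 0 := by exact_mod_cast h
    positivity
  · have : (c 1 : ℝ) ≠ 0 := by exact_mod_cast h
    positivity

theorem IsTransverse.linear_ne_zero {x m : Plane} (h : IsTransverse x m) {c : Fin 3 → ℚ}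
    (hc : IsNonconstant c) (hx : rationalForm c x = 0) : rationalForm.linear c m ≠ 0 := by
  intro h0
  -- If the form were constant along `m`, transversality would make it vanish everywhere; a step
  -- along the gradient refutes this.
  obtain ⟨s, hs⟩ := h (x + (1 : ℝ) • ![(c 0 : ℝ), (c 1 : ℝ)])
  have := hs c hx
  rw [rationalForm_add_smul_gradient, hx, h0] at this
  linarith [hc.sq_pos]

theorem IsNonconstant.dense {c : Fin 3 → ℚ} (hc : IsNonconstant c) :
    Dense {x | rationalForm c x ≠ 0} := by
  intro x
  by_cases hx : rationalForm c x = 0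
  · have ht : Filter.Tendsto (fun s : ℝ => x + s • ![(c 0 : ℝ), (c 1 : ℝ)]) (𝓝[≠] 0) (𝓝 x) := by
      have : ContinuousAt (fun s : ℝ => x + s • ![(c 0 : ℝ), (c 1 : ℝ)]) 0 := by fun_prop
      simpa [ContinuousAt] using this.mono_left nhdsWithin_le_nhds
    refine mem_closure_of_tendsto ht (eventually_mem_nhdsWithin.mono fun s hs => ?_)
    show rationalForm c _ ≠ 0
    rw [rationalForm_add_smul_gradient, hx, zero_add]
    exact mul_ne_zero hs hc.sq_pos.ne'
  · exact subset_closure hx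

theorem tendsto_add_smul (x m : Plane) :
    Filter.Tendsto (fun s : ℝ => x + s • m) (𝓝[>] 0) (𝓝 x) := by
  have : ContinuousAt (fun s : ℝ => x + s • m) 0 := by fun_prop
  simpa [ContinuousAt] using this.mono_left nhdsWithin_le_nhds

theorem IsTransverse.eventually_ne_zero {x m : Plane} (h : IsTransverse x m) {c : Fin 3 → ℚ}
    (hc : IsNonconstant c) : ∀ᶠ s : ℝ in 𝓝[>] 0, rationalForm c (x + s • m) ≠ 0 := by
  by_cases hx : rationalForm c x = 0
  · filter_upwards [self_mem_nhdsWithin] with s hs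
    rw [rationalForm_add_smul, hx, zero_add]
    exact mul_ne_zero (ne_of_gt hs) (h.linear_ne_zero hc hx)
  · exact (tendsto_add_smul x m).eventually
      ((continuous_rationalForm c).continuousAt.eventually_ne hx)

/-! ### Simplices in barycentric coordinates -/

theorem rationalForm_sum (c : Fin 3 → ℚ) {ι : Type*} [Fintype ι] (w : ι → ℝ) (hw : ∑ i, w i = 1)
    (p : ι → Plane) : rationalForm c (∑ i, w i • p i) = ∑ i, w i * rationalForm c (p i) := by
  simp only [rationalForm, Finset.sum_apply, Pi.smul_apply, smul_eq_mul, mul_add,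
    Finset.sum_add_distrib, ← Finset.sum_mul, hw, one_mul, Finset.mul_sum]
  simp only [mul_left_comm]

theorem det_ne_zero_of_affineIndependent {p : Fin 3 → Plane} (hp : AffineIndependent ℝ p) :
    (p 1 0 - p 0 0) * (p 2 1 - p 0 1) - (p 1 1 - p 0 1) * (p 2 0 - p 0 0) ≠ 0 := by
  intro h0
  -- Cyclic differences of `j`-th coordinates are the coefficients of an affine relation: its `j`-th
  -- component cancels identically, and the other is the determinant up to sign.
  have h1 := fun j => (affineIndependent_iff.1 hp) Finset.univ
    ![p 1 j - p 2 j, p 2 j - p 0 j, p 0 j - p 1 j]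
    (by simp [Fin.sum_univ_three]) (by
      ext i
      fin_cases i <;> fin_cases j <;> simp [Fin.sum_univ_three] <;>
        first | ring1 | linear_combination h0 | linear_combination -h0) 2 (Finset.mem_univ _)
  have h2 : p 0 = p 1 := funext fun j => by simpa [sub_eq_zero] using h1 j
  exact absurd (hp.injective h2) (by decide)

/-- Barycentric coordinates of an open triangle with rational vertices. -/
theorem IsRationalOpenSimplex.exists_barycentric {S : Set Plane}
    (hS : IsRationalOpenSimplex 2 S) : ∃ c : Fin 3 → Fin 3 → ℚ,
      (∀ i, IsNonconstant (c i)) ∧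
      S = {x | ∀ i, 0 < rationalForm (c i) x} ∧ closure S = {x | ∀ i, 0 ≤ rationalForm (c i) x} ∧
      ∀ i j x, i ≠ j → rationalForm (c i) x = 0 → rationalForm (c j) x = 0 →
        IsRationalPoint x := by
  obtain ⟨p, hp, hr, rfl⟩ := hS
  have hD := det_ne_zero_of_affineIndependent hp
  choose q hq using hr
  simp only [hq] at hD
  set D : ℚ := (q 1 0 - q 0 0) * (q 2 1 - q 0 1) - (q 1 1 - q 0 1) * (q 2 0 - q 0 0) with hDdef
  have hD' : (D : ℝ) ≠ 0 := by rw [hDdef]; push_cast; exact hD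
  -- The `i`-th barycentric coordinate is the signed area with vertex `i` replaced by `x`, divided
  -- by that of the triangle. Indices are modulo 3.
  let c : Fin 3 → Fin 3 → ℚ := fun i => ![(q (i + 1) 1 - q (i + 2) 1) / D,
    (q (i + 2) 0 - q (i + 1) 0) / D, (q (i + 1) 0 * q (i + 2) 1 - q (i + 1) 1 * q (i + 2) 0) / D]
  have hform : ∀ i x, rationalForm (c i) x = ((q (i + 1) 1 - q (i + 2) 1) * x 0 +
      (q (i + 2) 0 - q (i + 1) 0) * x 1 +
      (q (i + 1) 0 * q (i + 2) 1 - q (i + 1) 1 * q (i + 2) 0)) / D := by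
    intro i x
    simp [rationalForm, c]
    ring
  have hDr : (D : ℝ) = (q 1 0 - q 0 0) * (q 2 1 - q 0 1) - (q 1 1 - q 0 1) * (q 2 0 - q 0 0) := by
    rw [hDdef]; push_cast; rfl
  have hpp : ∀ i j, rationalForm (c i) (p j) = if i = j then 1 else 0 := by
    intro i j
    rw [hform, hq, hq, div_eq_iff hD', hDr]
    fin_cases i <;> fin_cases j <;> simp <;> ring
  have hsum : ∀ x, ∑ i, rationalForm (c i) x = 1 := by
    intro x
    simp only [hform, Fin.sum_univ_three, ← add_div]
    rw [div_eq_one_iff_eq hD', hDr]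
    simp
    ring
  have hcomb : ∀ x, x = ∑ i, rationalForm (c i) x • p i := by
    intro x
    ext j
    simp only [Finset.sum_apply, Pi.smul_apply, smul_eq_mul, hform, Fin.sum_univ_three, hq,
      div_mul_eq_mul_div, ← add_div]
    rw [eq_div_iff hD', hDr]
    fin_cases j <;> simp <;> ring
  have hw : ∀ w : Fin 3 → ℝ, ∑ i, w i = 1 → ∀ j, rationalForm (c j) (∑ i, w i • p i) = w j := by
    intro w hw j
    rw [rationalForm_sum _ _ hw]
    simp [hpp]
  have hS : openSimplex p = {x | ∀ i, 0 < rationalForm (c i) x} := by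
    ext x
    constructor
    · rintro ⟨w, hw0, hw1, rfl⟩ i
      rw [hw w hw1]
      exact hw0 i
    · exact fun hx => ⟨_, hx, hsum x, hcomb x⟩
  refine ⟨c, fun i => ?_, hS, ?_, ?_⟩
  · by_contra h
    simp only [IsNonconstant, not_or, not_not] at h
    have h1 := hpp i i
    have h2 := hpp i (i + 1)
    have h3 : i ≠ i + 1 := by fin_cases i <;> decide
    rw [if_neg h3] at h2
    simp only [rationalForm, h.1, h.2, if_true, Rat.cast_zero] at h1 h2
    linarith
  · refine Set.Subset.antisymm (closure_minimal ?_ ?_) fun x hx => ?_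
    · rw [hS]
      exact fun x hx i => (hx i).le
    · simp only [Set.ofPred_forall]
      exact isClosed_iInter fun i => isClosed_le continuous_const (continuous_rationalForm _)
    · obtain ⟨y, hy⟩ := openSimplex_nonempty p
      -- Moving from `x` towards the inner point `y` makes all coordinates positive at once.
      have h1 : openSegment ℝ x y ⊆ openSimplex p := by
        rw [hS] at hy ⊢
        rintro _ ⟨s, t, hs, ht, hst, rfl⟩ i
        have h2 : rationalForm (c i) (s • x + t • y) =
            s * rationalForm (c i) x + t * rationalForm (c i) y := by
          obtain rfl : s = 1 - t := by linarith
          simp [rationalForm]; ring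
        rw [h2]
        have := mul_nonneg hs.le (hx i)
        have := mul_pos ht (hy i)
        linarith
      have h3 := closure_mono h1
      rw [closure_openSegment] at h3
      exact h3 (left_mem_segment ℝ x y)
  · intro i j x hij hi hj
    -- If two barycentric coordinates vanish, the third is 1 and the point is a vertex.
    have h1 : ∃ k, x = p k := by
      have h2 := hcomb x
      have h3 := hsum x
      rw [Fin.sum_univ_three] at h2 h3
      fin_cases i <;> fin_cases j <;> simp at hij hi hj <;> simp [hi, hj] at h2 h3 <;>
        rw [h3, one_smul] at h2 <;> exact ⟨_, h2⟩
    obtain ⟨k, rfl⟩ := h1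
    exact fun j => ⟨_, hq k j⟩

/-- Points and edges lie on rational lines, so they are avoided by density and by small transverse
displacements. -/
theorem IsRationalOpenSimplex.exists_rationalForm_eq_zero {k : ℕ} (hk : k ≤ 1) {S : Set Plane}
    (hS : IsRationalOpenSimplex k S) :
    ∃ c, IsNonconstant c ∧ ∀ x ∈ S, rationalForm c x = 0 := by
  obtain ⟨p, hp, hr, rfl⟩ := hS
  choose q hq using hr
  interval_cases k
  · refine ⟨![1, 0, -q 0 0], Or.inl (by simp), ?_⟩
    rintro _ ⟨w, -, hw, rfl⟩
    have hw0 : w 0 = 1 := by simpa using hw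
    simp [hw0, rationalForm, hq]
  · refine ⟨![q 0 1 - q 1 1, q 1 0 - q 0 0, q 0 0 * q 1 1 - q 0 1 * q 1 0], ?_, ?_⟩
    · by_contra h
      simp [IsNonconstant, sub_eq_zero] at h
      have : p 0 = p 1 := funext fun j => by
        rw [hq, hq]
        fin_cases j
        · simp [h.2]
        · simp [h.1]
      exact absurd (hp.injective this) (by decide)
    · rintro _ ⟨w, -, hw, rfl⟩
      rw [rationalForm_sum _ _ hw]
      simp [Fin.sum_univ_two, rationalForm, hq]
      ring

theorem IsRationalOpenSimplex.isOpen {S : Set Plane} (hS : IsRationalOpenSimplex 2 S) :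
    IsOpen S := by
  obtain ⟨c, -, hSc, -, -⟩ := hS.exists_barycentric
  rw [hSc]
  simp only [Set.ofPred_forall]
  exact isOpen_iInter_of_finite fun i => isOpen_lt continuous_const (continuous_rationalForm _)

/-- Near a generic boundary point, an open triangle with rational vertices is a half-plane. -/
theorem IsRationalOpenSimplex.exists_local_form {S : Set Plane}
    (hS : IsRationalOpenSimplex 2 S) {x : Plane} (hx : IsGeneric x) (hxS : x ∈ frontier S) :
    ∃ c, IsNonconstant c ∧ rationalForm c x = 0 ∧ (∀ y ∈ S, 0 < rationalForm c y) ∧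
      (∀ᶠ y in 𝓝 x, 0 < rationalForm c y → y ∈ S) ∧
      ∀ᶠ y in 𝓝 x, 0 ≤ rationalForm c y → y ∈ closure S := by
  obtain ⟨c, hc, hSc, hcl, hv⟩ := hS.exists_barycentric
  have h1 : ∀ i, 0 ≤ rationalForm (c i) x := by
    have := frontier_subset_closure hxS
    rwa [hcl] at this
  have h2 : ¬ ∀ i, 0 < rationalForm (c i) x := by
    intro h
    rw [hS.isOpen.frontier_eq] at hxS
    exact hxS.2 (by rw [hSc]; exact h)
  push Not at h2
  obtain ⟨i, hi⟩ := h2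
  have hi0 : rationalForm (c i) x = 0 := le_antisymm hi (h1 i)
  have hpos : ∀ j, j ≠ i → 0 < rationalForm (c j) x := fun j hj =>
    lt_of_le_of_ne (h1 j) fun h => hx.not_isRationalPoint (hv j i x hj h.symm hi0)
  have hev : ∀ᶠ y in 𝓝 x, ∀ j, j ≠ i → 0 < rationalForm (c j) y := by
    rw [Filter.eventually_all]
    intro j
    by_cases hj : j = i
    · simp [hj]
    · filter_upwards [(continuous_rationalForm (c j)).continuousAt.eventually_const_lt
        (hpos j hj)] with y hy _ using hy
  refine ⟨c i, hc i, hi0, fun y hy => ?_, hev.mono fun y hy h0 => ?_, hev.mono fun y hy h0 => ?_⟩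
  · rw [hSc] at hy
    exact hy i
  · rw [hSc]
    intro j
    by_cases hj : j = i
    · rwa [hj]
    · exact hy j hj
  · rw [hcl]
    intro j
    by_cases hj : j = i
    · rwa [hj]
    · exact (hy j hj).le

theorem IsPolygon.subset_closure_interior {P : Set Plane} (hP : IsPolygon P) :
    P ⊆ closure (interior P) := by
  obtain ⟨n, t, -, ht, rfl⟩ := hP
  refine Set.iUnion_subset fun i => ?_
  have h1 : (interior (convexHull ℝ (Set.range (t i)))).Nonempty := by
    rw [interior_convexHull_nonempty_iff_affineSpan_eq_top]
    exact (ht i).affineSpan_eq_top_iff_card_eq_finrank_add_one.2 (by simp)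
  have h2 := (convex_convexHull ℝ (Set.range (t i))).closure_interior_eq_closure_of_nonempty_interior
    h1
  exact (subset_closure.trans h2.ge).trans
    (closure_mono (interior_mono (Set.subset_iUnion (fun i => convexHull ℝ (Set.range (t i))) i)))

/-! ### Facets around a generic point of a triangulation. -/

section Triangulation

variable {T : Set (Set Plane)} {P : Set Plane}

theorem IsTriangulation.exists_rationalForm_eq_zero (hT : IsTriangulation T P) {S : Set Plane}
    (hS : S ∈ T \ facets T) : ∃ c, IsNonconstant c ∧ ∀ x ∈ S, rationalForm c x = 0 := by
  obtain ⟨k, hk, hS'⟩ := hT.simplex S hS.1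
  refine hS'.exists_rationalForm_eq_zero ?_
  by_contra hk1
  obtain rfl : k = 2 := by omega
  exact hS.2 ⟨hS.1, hS'⟩

theorem facets_subset (T : Set (Set Plane)) : facets T ⊆ T := Set.sep_subset _ _

theorem IsTriangulation.subset (hT : IsTriangulation T P) {S : Set Plane} (hS : S ∈ T) : S ⊆ P :=
  hT.union ▸ Set.subset_sUnion_of_mem hS

/-- The simplices of lower dimension lie on finitely many lines. Interior points of `P` off these
lines lie in open facets, and they are dense in `P`. -/
theorem IsTriangulation.subset_closure_facets (hT : IsTriangulation T P) (hP : IsPolygon P) :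
    P ⊆ ⋃ S ∈ facets T, closure S := by
  have hfin := hT.finite.subset (facets_subset T)
  choose! c hc h0 using fun S => hT.exists_rationalForm_eq_zero (S := S)
  have hfin' : (T \ facets T).Finite := hT.finite.subset Set.sdiff_subset
  have hd : Dense (⋂ S ∈ T \ facets T, {x | rationalForm (c S) x ≠ 0}) := by
    refine dense_biInter_of_isOpen (fun S hS => ?_) hfin'.countable fun S hS => (hc S hS).dense
    exact isOpen_ne_fun (continuous_rationalForm _) continuous_const
  have h1 : interior P ∩ (⋂ S ∈ T \ facets T, {x | rationalForm (c S) x ≠ 0}) ⊆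
      ⋃ S ∈ facets T, S := by
    rintro x ⟨hx, hx'⟩
    have hxP := interior_subset hx
    rw [← hT.union] at hxP
    obtain ⟨S, hS, hxS⟩ := hxP
    simp only [Set.mem_iInter] at hx'
    refine Set.mem_biUnion (x := S) ?_ hxS
    by_contra hSf
    exact hx' S ⟨hS, hSf⟩ (h0 S ⟨hS, hSf⟩ x hxS)
  have h2 := closure_mono h1
  rw [hfin.closure_biUnion] at h2
  refine Set.Subset.trans ?_ h2
  refine hP.subset_closure_interior.trans (closure_minimal ?_ isClosed_closure)
  exact hd.open_subset_closure_inter isOpen_interior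

/-- An open facet containing a boundary point of `S` would meet `S`, against disjointness. -/
theorem IsTriangulation.frontier_facet_subset (hT : IsTriangulation T P) (hP : IsPolygon P)
    {S : Set Plane} (hS : S ∈ facets T) : frontier S ⊆ P \ ⋃₀ facets T := by
  intro x hx
  refine ⟨hP.isCompact.isClosed.closure_subset_iff.2 (hT.subset hS.1)
    (frontier_subset_closure hx), ?_⟩
  rintro ⟨S', hS', hxS'⟩
  obtain ⟨y, hy, hy'⟩ := mem_closure_iff.1 (frontier_subset_closure hx) S' hS'.2.isOpen hxS'
  obtain rfl : S' = S := by
    by_contra hne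
    exact Set.disjoint_left.1 (hT.disjoint hS'.1 hS.1 hne) hy hy'
  rw [hS.2.isOpen.frontier_eq] at hx
  exact hx.2 hxS'

theorem IsTriangulation.frontier_subset (hT : IsTriangulation T P) (hP : IsPolygon P) :
    frontier P ⊆ P \ ⋃₀ facets T := by
  intro x hx
  refine ⟨hP.isCompact.isClosed.frontier_subset hx, ?_⟩
  rintro ⟨S, hS, hxS⟩
  exact hx.2 (mem_interior.2 ⟨S, hT.subset hS.1, hS.2.isOpen, hxS⟩)

open Classical in
/-- A generic point outside the open facets lies on the boundary of one or two facets, according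
to whether it is on the boundary of the polygon. -/
theorem IsTriangulation.ncard_facets_frontier (hT : IsTriangulation T P) (hP : IsPolygon P)
    {x : Plane} (hx : IsGeneric x) (hxP : x ∈ P \ ⋃₀ facets T) :
    {S ∈ facets T | x ∈ frontier S}.ncard + (if x ∈ frontier P then 1 else 0) = 2 := by
  have hloc : ∀ S ∈ facets T, x ∈ closure S → x ∈ frontier S := by
    intro S hS h
    rw [hS.2.isOpen.frontier_eq]
    exact ⟨h, fun h' => hxP.2 ⟨S, hS, h'⟩⟩
  obtain ⟨S₀, hS₀, hx₀⟩ : ∃ S ∈ facets T, x ∈ frontier S := by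
    have := hT.subset_closure_facets hP hxP.1
    simp only [Set.mem_iUnion] at this
    obtain ⟨S, hS, h⟩ := this
    exact ⟨S, hS, hloc S hS h⟩
  obtain ⟨c₀, hc₀, hz₀, hpos₀, hin₀, hcl₀⟩ := hS₀.2.exists_local_form hx hx₀
  -- Orient the transverse direction so that it points into `S₀`.
  obtain ⟨m, hm, hm₀⟩ : ∃ m, IsTransverse x m ∧ 0 < rationalForm.linear c₀ m := by
    obtain ⟨m, hm⟩ := hx.exists_isTransverse
    rcases lt_or_gt_of_ne (hm.linear_ne_zero hc₀ hz₀) with h | h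
    · exact ⟨-m, hm.neg, by rw [rationalForm.linear_neg]; linarith⟩
    · exact ⟨m, hm, h⟩
  have hside : ∀ (S : Set Plane) (c : Fin 3 → ℚ) (m : Plane), rationalForm c x = 0 →
      (∀ᶠ y in 𝓝 x, 0 < rationalForm c y → y ∈ S) → 0 < rationalForm.linear c m →
      ∀ᶠ s : ℝ in 𝓝[>] 0, x + s • m ∈ S := by
    intro S c m hz hin hl
    filter_upwards [(tendsto_add_smul x m).eventually hin, self_mem_nhdsWithin] with s hs hs0
    refine hs ?_
    rw [rationalForm_add_smul, hz, zero_add]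
    exact mul_pos hs0 hl
  have huniq : ∀ S ∈ facets T, ∀ S' ∈ facets T, ∀ m : Plane,
      (∀ᶠ s : ℝ in 𝓝[>] 0, x + s • m ∈ S) → (∀ᶠ s : ℝ in 𝓝[>] 0, x + s • m ∈ S') → S = S' := by
    intro S hS S' hS' m h h'
    obtain ⟨s, hs, hs'⟩ := (h.and h').exists
    by_contra hne
    exact Set.disjoint_left.1 (hT.disjoint hS.1 hS'.1 hne) hs hs'
  by_cases hex : ∃ S ∈ facets T, x ∈ frontier S ∧ S ≠ S₀
  · obtain ⟨S₁, hS₁, hx₁, hne⟩ := hex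
    obtain ⟨c₁, hc₁, hz₁, hpos₁, hin₁, hcl₁⟩ := hS₁.2.exists_local_form hx hx₁
    -- Two facets on the same side of the line share points near `x`, so `S₁` lies on the other
    -- side, and there is no room for a third.
    have hm₁ : rationalForm.linear c₁ m < 0 := by
      rcases lt_or_gt_of_ne (hm.linear_ne_zero hc₁ hz₁) with h | h
      · exact h
      · exact absurd (huniq S₁ hS₁ S₀ hS₀ m (hside _ _ _ hz₁ hin₁ h)
          (hside _ _ _ hz₀ hin₀ hm₀)) hne
    have hset : {S ∈ facets T | x ∈ frontier S} = {S₀, S₁} := by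
      ext S
      simp only [Set.mem_ofPred_eq, Set.mem_insert_iff, Set.mem_singleton_iff]
      constructor
      · rintro ⟨hS, hxS⟩
        obtain ⟨c, hc, hz, hpos, hin, hcl⟩ := hS.2.exists_local_form hx hxS
        rcases lt_or_gt_of_ne (hm.linear_ne_zero hc hz) with h | h
        · refine Or.inr (huniq S hS S₁ hS₁ (-m) (hside _ _ _ hz hin ?_)
            (hside _ _ _ hz₁ hin₁ ?_)) <;> rw [rationalForm.linear_neg] <;> linarith
        · exact Or.inl (huniq S hS S₀ hS₀ m (hside _ _ _ hz hin h) (hside _ _ _ hz₀ hin₀ hm₀))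
      · rintro (rfl | rfl)
        · exact ⟨hS₀, hx₀⟩
        · exact ⟨hS₁, hx₁⟩
    -- The closures of `S₀` and `S₁` are opposite closed half-planes near `x` and cover a
    -- neighbourhood.
    have hint : x ∉ frontier P := by
      intro hfr
      refine hfr.2 (mem_interior_iff_mem_nhds.2 ?_)
      filter_upwards [hcl₀, hcl₁] with y h0 h1
      have hsub : ∀ S ∈ facets T, closure S ⊆ P := fun S hS =>
        hP.isCompact.isClosed.closure_subset_iff.2 (hT.subset hS.1)
      obtain ⟨s, hs⟩ := hm y
      rcases le_total 0 s with h | h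
      · exact hsub _ hS₀ (h0 (by rw [hs _ hz₀]; exact mul_nonneg h hm₀.le))
      · exact hsub _ hS₁ (h1 (by rw [hs _ hz₁]; exact mul_nonneg_of_nonpos_of_nonpos h hm₁.le))
    rw [hset, Set.ncard_pair hne.symm, if_neg hint]
  · push Not at hex
    have hset : {S ∈ facets T | x ∈ frontier S} = {S₀} := by
      ext S
      simp only [Set.mem_ofPred_eq, Set.mem_singleton_iff]
      exact ⟨fun h => hex S h.1 h.2, by rintro rfl; exact ⟨hS₀, hx₀⟩⟩
    -- Were `x` interior, small steps along `-m` would stay in `P`. But they leave `S₀`, avoid the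
    -- facets whose closure misses `x`, and avoid the finitely many lines carrying the other
    -- simplices.
    have hfr : x ∈ frontier P := by
      refine ⟨subset_closure hxP.1, fun hint => ?_⟩
      have h1 : ∀ᶠ s : ℝ in 𝓝[>] 0, x + s • (-m) ∈ P :=
        (tendsto_add_smul x (-m)).eventually (mem_interior_iff_mem_nhds.1 hint)
      have h2 : ∀ S ∈ T, ∀ᶠ s : ℝ in 𝓝[>] 0, x + s • (-m) ∉ S := by
        intro S hS
        by_cases hSf : S ∈ facets T
        · by_cases hxS : x ∈ closure S
          · obtain rfl := hex S hSf (hloc S hSf hxS)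
            filter_upwards [self_mem_nhdsWithin] with s hs hmem
            have := hpos₀ _ hmem
            rw [rationalForm_add_smul, hz₀, rationalForm.linear_neg] at this
            have : 0 < s * rationalForm.linear c₀ m := mul_pos hs hm₀
            linarith
          · filter_upwards [(tendsto_add_smul x (-m)).eventually
              (isClosed_closure.isOpen_compl.mem_nhds hxS)] with s hs hmem
            exact hs (subset_closure hmem)
        · obtain ⟨c, hc, h0⟩ := hT.exists_rationalForm_eq_zero ⟨hS, hSf⟩
          filter_upwards [hm.neg.eventually_ne_zero hc] with s hs hmem
          exact hs (h0 _ hmem)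
      obtain ⟨s, hs, hs'⟩ := (h1.and ((Filter.eventually_all_finite hT.finite).2 h2)).exists
      rw [← hT.union] at hs
      obtain ⟨S, hS, hmem⟩ := hs
      exact hs' S hS hmem
    rw [hset, Set.ncard_singleton, if_pos hfr]

/-- Double counting of generic points on the edges of a triangulation. -/
theorem IsTriangulation.sum_ncard_frontier (hT : IsTriangulation T P) (hP : IsPolygon P)
    {X : Set Plane} (hX : ∀ x ∈ X, IsGeneric x) (hfin : (X ∩ (P \ ⋃₀ facets T)).Finite) :
    ∑ᶠ S ∈ facets T, (X ∩ frontier S).ncard + (X ∩ frontier P).ncard =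
      2 * (X ∩ (P \ ⋃₀ facets T)).ncard := by
  classical
  have hff := hT.finite.subset (facets_subset T)
  have key : ∀ A ⊆ P \ ⋃₀ facets T, (X ∩ A).ncard = (hfin.toFinset.filter (· ∈ A)).card := by
    intro A hA
    rw [← Set.ncard_coe_finset]
    congr 1
    ext x
    simp only [Finset.coe_filter, Set.Finite.mem_toFinset, Set.mem_inter_iff, Set.mem_ofPred_eq]
    exact ⟨fun h => ⟨⟨h.1, hA h.2⟩, h.2⟩, fun h => ⟨h.1.1, h.2⟩⟩
  rw [finsum_mem_eq_finite_toFinset_sum _ hff, key _ (hT.frontier_subset hP)]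
  have h1 : ∑ S ∈ hff.toFinset, (X ∩ frontier S).ncard =
      ∑ S ∈ hff.toFinset, (hfin.toFinset.filter (· ∈ frontier S)).card :=
    Finset.sum_congr rfl fun S hS =>
      key _ (hT.frontier_facet_subset hP (hff.mem_toFinset.1 hS))
  rw [h1]
  simp only [Finset.card_filter]
  rw [Finset.sum_comm, ← Finset.sum_add_distrib, Set.ncard_eq_toFinset_card _ hfin, mul_comm,
    ← smul_eq_mul, ← Finset.sum_const]
  refine Finset.sum_congr rfl fun x hx => ?_
  have hx' := hfin.mem_toFinset.1 hx
  refine Eq.trans ?_ (hT.ncard_facets_frontier hP (hX x hx'.1) hx'.2)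
  rw [← Finset.card_filter, ← Set.ncard_coe_finset]
  congr 2
  ext S
  simp

end Triangulation

/-! ### Segments of a lattice -/

open AffineMap (lineMap)

theorem mem_lattice_mul {d : ℕ} {x : Plane} (hx : x ∈ lattice d) {m : ℕ} (hm : 0 < m) :
    x ∈ lattice (d * m) := by
  obtain ⟨a, rfl⟩ := hx
  refine ⟨fun i => a i * m, funext fun i => ?_⟩
  have : (m : ℝ) ≠ 0 := by positivity
  simp only [latticePoint]
  push_cast
  rw [mul_div_mul_right _ _ this]

theorem IsRationalPoint.exists_mem_lattice {x : Plane} (hx : IsRationalPoint x) :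
    ∃ d, 0 < d ∧ x ∈ lattice d := by
  choose q hq using hx
  refine ⟨(q 0).den * (q 1).den, Nat.mul_pos (q 0).den_pos (q 1).den_pos,
    ![(q 0).num * (q 1).den, (q 1).num * (q 0).den], funext fun i => ?_⟩
  have h0 : ((q 0).den : ℝ) ≠ 0 := by exact_mod_cast (q 0).den_nz
  have h1 : ((q 1).den : ℝ) ≠ 0 := by exact_mod_cast (q 1).den_nz
  rw [hq]
  fin_cases i
  · show ((((q 0).num * (q 1).den : ℤ) : ℝ) / (((q 0).den * (q 1).den : ℕ) : ℝ)) = (q 0 : ℝ)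
    rw [Rat.cast_def (q 0)]
    push_cast
    field_simp
  · show ((((q 1).num * (q 0).den : ℤ) : ℝ) / (((q 0).den * (q 1).den : ℕ) : ℝ)) = (q 1 : ℝ)
    rw [Rat.cast_def (q 1)]
    push_cast
    field_simp

theorem openSegment_lineMap (p q : Plane) {s t : ℝ} (h : s < t) :
    openSegment ℝ (lineMap p q s) (lineMap p q t) = lineMap p q '' Set.Ioo s t := by
  rw [← openSegment_eq_Ioo h, ← image_openSegment]

/-- Genericity does not depend on the rational points that span the line: a rational parameter would
make the point rational. -/
theorem isGenericOn_of_mem_segment {p q x : Plane} (hx : IsGeneric x) (hp : IsRationalPoint p)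
    (hq : IsRationalPoint q) (h : x ∈ segment ℝ p q) :
    IsGenericOn p q x ∧ ∃ t ∈ Set.Ioo (0 : ℝ) 1, x = lineMap p q t := by
  have hne : p ≠ q := by
    rintro rfl
    rw [segment_same] at h
    exact hx.not_isRationalPoint (by rwa [Set.mem_singleton_iff.1 h])
  rw [segment_eq_image_lineMap] at h
  obtain ⟨t, ht, rfl⟩ := h
  have hirr : Irrational t := by
    rintro ⟨r, rfl⟩
    refine hx.not_isRationalPoint fun i => ?_
    obtain ⟨a, ha⟩ := hp i
    obtain ⟨b, hb⟩ := hq i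
    exact ⟨r * (b - a) + a, by simp [AffineMap.lineMap_apply, ha, hb]⟩
  refine ⟨⟨hp, hq, hne, t, hirr, ?_⟩, t, ⟨lt_of_le_of_ne ht.1 ?_, lt_of_le_of_ne ht.2 ?_⟩, rfl⟩
  · simp [AffineMap.lineMap_apply, add_comm]
  · rintro rfl; exact hirr.ne_zero rfl
  · rintro rfl; exact hirr.ne_one rfl

/-- A rational form cutting out the line through two distinct rational points. -/
theorem exists_lineMap_of_rationalForm {p q : Plane} (hp : IsRationalPoint p)
    (hq : IsRationalPoint q) (hne : p ≠ q) : ∃ c, (∀ t : ℝ, rationalForm c (lineMap p q t) = 0) ∧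
      ∀ y, rationalForm c y = 0 → ∃ t : ℝ, y = lineMap p q t := by
  choose a ha using hp
  choose b hb using hq
  refine ⟨![a 1 - b 1, b 0 - a 0, a 0 * b 1 - a 1 * b 0], fun t => ?_, fun y hy => ?_⟩
  · simp [rationalForm, AffineMap.lineMap_apply, ha, hb]
    ring
  · simp [rationalForm, ← ha, ← hb] at hy
    have hN : (q 0 - p 0) ^ 2 + (q 1 - p 1) ^ 2 ≠ 0 := by
      intro h0
      refine hne (funext fun i => ?_)
      fin_cases i
      · show p 0 = q 0
        nlinarith [sq_nonneg (q 0 - p 0), sq_nonneg (q 1 - p 1)]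
      · show p 1 = q 1
        nlinarith [sq_nonneg (q 0 - p 0), sq_nonneg (q 1 - p 1)]
    refine ⟨((y 0 - p 0) * (q 0 - p 0) + (y 1 - p 1) * (q 1 - p 1)) /
      ((q 0 - p 0) ^ 2 + (q 1 - p 1) ^ 2), funext fun i => ?_⟩
    simp only [AffineMap.lineMap_apply, vsub_eq_sub, vadd_eq_add, Pi.add_apply, Pi.smul_apply,
      Pi.sub_apply, smul_eq_mul]
    rw [← sub_eq_iff_eq_add, div_mul_eq_mul_div, eq_div_iff hN]
    fin_cases i
    · show (y 0 - p 0) * _ = _ * (q 0 - p 0)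
      linear_combination (-(q 1 - p 1)) * hy
    · show (y 1 - p 1) * _ = _ * (q 1 - p 1)
      linear_combination (q 0 - p 0) * hy

/-- The form of the line of `E'` vanishes at `x`, hence on `E`, so both segments lie on one line.
There they are overlapping intervals, neither having an endpoint of the other in its interior. -/
theorem IsMinimalSegment.eq_of_mem {d : ℕ} {E E' : Set Plane} (hE : IsMinimalSegment d E)
    (hE' : IsMinimalSegment d E') {x : Plane} (hx : IsGeneric x) (hxE : x ∈ E) (hxE' : x ∈ E') :
    E = E' := by
  obtain ⟨p, q, hpq, rfl, hL⟩ := hE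
  obtain ⟨p', q', hpq', rfl, hL'⟩ := hE'
  have mem : ∀ {r : Plane} {A B : Set Plane}, r ∈ A → B ∩ lattice d = A → r ∈ lattice d := by
    rintro r A B h rfl
    exact h.2
  have hp : p ∈ lattice d := mem (Or.inl rfl) hL
  have hq : q ∈ lattice d := mem (Or.inr rfl) hL
  have hp' : p' ∈ lattice d := mem (Or.inl rfl) hL'
  have hq' : q' ∈ lattice d := mem (Or.inr rfl) hL'
  have rat := @isRationalPoint_of_mem_lattice d
  obtain ⟨hgen, u, hu, hxu⟩ := isGenericOn_of_mem_segment hx (rat hp) (rat hq) hxE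
  obtain ⟨-, v, hv, hxv⟩ := isGenericOn_of_mem_segment hx (rat hp') (rat hq') hxE'
  obtain ⟨c, hc, hc'⟩ := exists_lineMap_of_rationalForm (rat hp') (rat hq') hpq'
  obtain ⟨h1, h2⟩ := hgen.rationalForm_eq_zero (c := c) (by rw [hxv]; exact hc v)
  obtain ⟨s, rfl⟩ := hc' p h1
  obtain ⟨t, rfl⟩ := hc' q h2
  have hinj : Function.Injective (lineMap p' q' : ℝ → Plane) := AffineMap.lineMap_injective ℝ hpq'
  have hvst : v = s + u * (t - s) := by
    apply hinj
    rw [← hxv, hxu, ← AffineMap.apply_lineMap]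
    simp [AffineMap.lineMap_apply, add_comm]
  have out : ∀ r : ℝ, lineMap p' q' r ∈ lattice d → 0 ≤ r → r ≤ 1 → r = 0 ∨ r = 1 := by
    intro r hr h0 h1
    have : lineMap p' q' r ∈ segment ℝ p' q' ∩ lattice d :=
      ⟨by rw [segment_eq_image_lineMap]; exact ⟨r, ⟨h0, h1⟩, rfl⟩, hr⟩
    rw [hL'] at this
    rcases this with h | h
    · left; apply hinj; simpa using h
    · right; apply hinj; simpa using h
  have hin : ∀ r : ℝ, (r = 0 ∨ r = 1) → r ∈ segment ℝ s t → r = s ∨ r = t := by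
    intro r hr hst
    have h3 : lineMap p' q' r ∈ segment ℝ (lineMap p' q' s) (lineMap p' q' t) ∩ lattice d := by
      refine ⟨?_, ?_⟩
      · rw [← image_segment]
        exact ⟨r, hst, rfl⟩
      · rcases hr with rfl | rfl
        · simpa using hp'
        · simpa using hq'
    rw [hL] at h3
    rcases h3 with h | h
    · exact Or.inl (hinj h)
    · exact Or.inr (hinj h)
  have hs := out s hp
  have ht := out t hq
  -- In the coordinate where `E'` is `[0, 1]`, `E` has ends `s`, `t`, and the common point has
  -- parameter `v`. Both orders of `s` and `t` occur.
  have key : ∀ s t : ℝ, s < t → (0 ≤ s → s ≤ 1 → s = 0 ∨ s = 1) →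
      (0 ≤ t → t ≤ 1 → t = 0 ∨ t = 1) →
      (∀ r : ℝ, (r = 0 ∨ r = 1) → r ∈ segment ℝ s t → r = s ∨ r = t) →
      s < v → v < t → s = 0 ∧ t = 1 := by
    intro s t hst hs ht hin hv1 hv2
    rw [segment_eq_Icc hst.le] at hin
    have hs0 : s ≤ 0 := by
      by_contra h
      rcases hs (by linarith) (by linarith [hv.2]) with h' | h' <;> linarith [hv.2]
    have ht1 : 1 ≤ t := by
      by_contra h
      rcases ht (by linarith [hv.1]) (by linarith) with h' | h' <;> linarith [hv.1]
    constructor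
    · rcases hin 0 (Or.inl rfl) ⟨hs0, by linarith⟩ with h | h <;> linarith
    · rcases hin 1 (Or.inr rfl) ⟨by linarith, ht1⟩ with h | h <;> linarith
  rcases lt_trichotomy s t with h | h | h
  · obtain ⟨rfl, rfl⟩ := key s t h hs ht hin (by nlinarith [hu.1]) (by nlinarith [hu.2])
    simp
  · exact absurd (congrArg _ h) hpq
  · rw [segment_symm] at hin
    obtain ⟨rfl, rfl⟩ := key t s h ht hs (fun r hr h' => (hin r hr h').symm) (by nlinarith [hu.2])
      (by nlinarith [hu.1])
    simp [segment_symm]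

theorem IsGMap.image_segment {g : Plane → Plane} (hg : IsGMap g) (p q : Plane) :
    g '' segment ℝ p q = segment ℝ (g p) (g q) := by
  obtain ⟨e, rfl, -⟩ := hg.exists_affineEquiv
  exact _root_.image_segment ℝ (e : Plane →ᵃ[ℝ] Plane) p q

theorem IsMinimalSegment.image {d : ℕ} (hd : 0 < d) {E : Set Plane} (hE : IsMinimalSegment d E)
    {g : Plane → Plane} (hg : IsGMap g) : IsMinimalSegment d (g '' E) := by
  obtain ⟨p, q, hpq, rfl, hL⟩ := hE
  refine ⟨g p, g q, fun h => hpq (hg.injective h), hg.image_segment p q, ?_⟩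
  rw [Set.inter_comm, (isGInvariant_lattice hd).inter_image hg, Set.inter_comm, hL,
    Set.image_pair]

/-- This is how the orbit of one generic point detects the `G`-class of a whole segment. -/
theorem IsMinimalSegment.eq_image {d : ℕ} (hd : 0 < d) {E E' : Set Plane}
    (hE : IsMinimalSegment d E) (hE' : IsMinimalSegment d E') {x : Plane} (hx : IsGeneric x)
    (hxE : x ∈ E) {g : Plane → Plane} (hg : IsGMap g) (hgx : g x ∈ E') : E' = g '' E :=
  hE'.eq_of_mem (hE.image hd hg) (isGInvariant_isGeneric g hg x hx) hgx ⟨x, hxE, rfl⟩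

theorem IsMinimalSegment.finite_gOrbit_inter {d : ℕ} (hd : 0 < d) {E : Set Plane}
    (hE : IsMinimalSegment d E) {x : Plane} (hx : IsGeneric x) : (gOrbit x ∩ E).Finite := by
  rcases (gOrbit x ∩ E).eq_empty_or_nonempty with h | ⟨x', hx', hx'E⟩
  · rw [h]; exact Set.finite_empty
  have hgen : IsGeneric x' := isGInvariant_isGeneric.gOrbit_subset hx hx'
  rw [← gOrbit_eq hx']
  obtain ⟨p, q, hpq, rfl, hL⟩ := id hE
  have hx'' := hx'E
  rw [segment_eq_image_lineMap] at hx''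
  obtain ⟨t, -, rfl⟩ := hx''
  refine (Set.toFinite {lineMap p q t, lineMap q p t}).subset ?_
  rintro _ ⟨⟨g, hg, rfl⟩, hy⟩
  -- A `G`-map returning the point to `E` maps `E` onto itself, so it fixes or swaps the endpoints:
  -- at most two points of the orbit lie on `E`.
  have h1 := hE.eq_image hd hE hgen hx'E hg hy
  have h2 : ({p, q} : Set Plane) = {g p, g q} := by
    rw [← Set.image_pair, ← hL, Set.inter_comm, ← (isGInvariant_lattice hd).inter_image hg, ← h1]
  have h3 : g (lineMap p q t) = lineMap (g p) (g q) t := by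
    obtain ⟨e, rfl, -⟩ := hg.exists_affineEquiv
    exact (e : Plane →ᵃ[ℝ] Plane).apply_lineMap p q t
  rw [h3]
  rcases Set.pair_eq_pair_iff.1 h2 with ⟨ha, hb⟩ | ⟨ha, hb⟩
  · left; rw [← ha, ← hb]
  · right; rw [← ha, ← hb]; rfl

theorem IsMinimalSegment.exists_isGeneric {d : ℕ} {E : Set Plane} (hE : IsMinimalSegment d E) :
    ∃ x ∈ E, IsGeneric x := by
  obtain ⟨p, q, hpq, rfl, hL⟩ := hE
  have hp : p ∈ segment ℝ p q ∩ lattice d := hL ▸ Or.inl rfl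
  have hq : q ∈ segment ℝ p q ∩ lattice d := hL ▸ Or.inr rfl
  obtain ⟨t, ht, h0, h1⟩ := exists_irrational_btwn (zero_lt_one (α := ℝ))
  refine ⟨lineMap p q t, ?_, p, q, isRationalPoint_of_mem_lattice hp.2,
    isRationalPoint_of_mem_lattice hq.2, hpq, t, ht, ?_⟩
  · rw [segment_eq_image_lineMap]
    exact ⟨t, ⟨h0.le, h1.le⟩, rfl⟩
  · simp [AffineMap.lineMap_apply, add_comm]

/-! ### Cells of a lattice -/

/-- A cell of `𝓛_d`: a lattice point, or a `d`-minimal segment without its endpoints. -/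
def IsCell (d : ℕ) (S : Set Plane) : Prop :=
  (∃ p ∈ lattice d, S = {p}) ∨ ∃ E, IsMinimalSegment d E ∧ S = E \ lattice d

theorem IsCell.finite_gOrbit_inter {d : ℕ} (hd : 0 < d) {S : Set Plane} (hS : IsCell d S)
    {x : Plane} (hx : IsGeneric x) : (gOrbit x ∩ S).Finite := by
  rcases hS with ⟨p, -, rfl⟩ | ⟨E, hE, rfl⟩
  · exact (Set.finite_singleton p).subset Set.inter_subset_right
  · exact (hE.finite_gOrbit_inter hd hx).subset
      (Set.inter_subset_inter_right _ Set.sdiff_subset)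

/-- Every cell has a point whose orbit meets only the cells that are equivalent to it. -/
theorem IsCell.exists_point {d : ℕ} (hd : 0 < d) {S : Set Plane} (hS : IsCell d S) :
    ∃ x ∈ S, (IsGeneric x ∨ IsRationalPoint x) ∧ (gOrbit x ∩ S).Finite ∧
      ∀ S', IsCell d S' → (gOrbit x ∩ S').Nonempty → GEquivalent S S' := by
  rcases hS with ⟨p, hp, rfl⟩ | ⟨E, hE, rfl⟩
  · refine ⟨p, rfl, Or.inr (isRationalPoint_of_mem_lattice hp),
      (Set.finite_singleton p).subset Set.inter_subset_right, ?_⟩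
    rintro S' (⟨p', hp', rfl⟩ | ⟨E', hE', rfl⟩) ⟨y, ⟨g, hg, rfl⟩, hy⟩
    · refine ⟨g, hg, ?_⟩
      rw [Set.image_singleton, Set.mem_singleton_iff.1 hy]
    · exact absurd (isGInvariant_lattice hd g hg p hp) hy.2
  · obtain ⟨x, hxE, hx⟩ := hE.exists_isGeneric
    refine ⟨x, ⟨hxE, fun h => hx.not_isRationalPoint (isRationalPoint_of_mem_lattice h)⟩,
      Or.inl hx, (hE.finite_gOrbit_inter hd hx).subset
        (Set.inter_subset_inter_right _ Set.sdiff_subset), ?_⟩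
    rintro S' (⟨p', hp', rfl⟩ | ⟨E', hE', rfl⟩) ⟨y, ⟨g, hg, rfl⟩, hy⟩
    · have h1 := (isGInvariant_isGeneric g hg x hx).not_isRationalPoint
      exact absurd (isRationalPoint_of_mem_lattice (Set.mem_singleton_iff.1 hy ▸ hp')) h1
    · refine ⟨g, hg, ?_⟩
      rw [hE.eq_image hd hE' hx hxE hg hy.1, Set.image_sdiff hg.injective]
      congr 1
      ext y
      obtain ⟨e, rfl, he⟩ := hg.exists_affineEquiv
      refine ⟨fun h => ⟨e.symm y, isGInvariant_lattice hd _ he _ h, by simp⟩, ?_⟩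
      rintro ⟨z, hz, rfl⟩
      exact isGInvariant_lattice hd _ hg _ hz

/-- `S` is a finite disjoint union of cells of `𝓛_d`. -/
def IsCellDecomposition (d : ℕ) (B : Set (Set Plane)) (S : Set Plane) : Prop :=
  B.Finite ∧ (∀ C ∈ B, IsCell d C) ∧ B.PairwiseDisjoint id ∧ ⋃₀ B = S

theorem isCellDecomposition_point {d : ℕ} {p : Plane} (hp : p ∈ lattice d) :
    IsCellDecomposition d {{p}} {p} := by
  refine ⟨Set.finite_singleton _, ?_, Set.pairwiseDisjoint_singleton _ _, Set.sUnion_singleton _⟩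
  rintro _ rfl
  exact Or.inl ⟨p, hp, rfl⟩

theorem IsCellDecomposition.union {d : ℕ} {B B' : Set (Set Plane)} {S S' : Set Plane}
    (h : IsCellDecomposition d B S) (h' : IsCellDecomposition d B' S') (hd : Disjoint S S') :
    IsCellDecomposition d (B ∪ B') (S ∪ S') := by
  obtain ⟨h1, h2, h3, rfl⟩ := h
  obtain ⟨h1', h2', h3', rfl⟩ := h'
  refine ⟨h1.union h1', fun C hC => hC.elim (h2 C) (h2' C), ?_, Set.sUnion_union _ _⟩
  refine Set.pairwiseDisjoint_union.2 ⟨h3, h3', fun C hC C' hC' _ => ?_⟩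
  exact hd.mono (Set.subset_sUnion_of_mem hC) (Set.subset_sUnion_of_mem hC')

/-- Induction on the number of interior lattice points, splitting the segment at one of them. -/
theorem exists_isCellDecomposition_openSegment {d : ℕ} (hd : 0 < d) {p q : Plane}
    (hp : p ∈ lattice d) (hq : q ∈ lattice d) (hpq : p ≠ q) :
    ∃ B, IsCellDecomposition d B (openSegment ℝ p q) := by
  have hfin : ∀ p q : Plane, (openSegment ℝ p q ∩ lattice d).Finite := fun p q =>
    (finite_lattice_inter hd (K := segment ℝ p q) (by
      rw [← convexHull_pair]; exact (Set.toFinite _).isCompact_convexHull ℝ)).subset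
      (Set.inter_subset_inter_left _ (openSegment_subset_segment ℝ p q))
  induction hn : (openSegment ℝ p q ∩ lattice d).ncard using Nat.strong_induction_on
    generalizing p q with
  | _ n ih =>
  rcases (openSegment ℝ p q ∩ lattice d).eq_empty_or_nonempty with h0 | ⟨r, hr, hrL⟩
  · refine ⟨{openSegment ℝ p q}, Set.finite_singleton _, ?_, Set.pairwiseDisjoint_singleton _ _,
      Set.sUnion_singleton _⟩
    rintro _ rfl
    have hsub : segment ℝ p q ∩ lattice d = {p, q} := by
      rw [← insert_endpoints_openSegment]
      ext y
      constructor
      · rintro ⟨rfl | rfl | h, hy⟩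
        · exact Or.inl rfl
        · exact Or.inr rfl
        · exact absurd (show y ∈ openSegment ℝ p q ∩ lattice d from ⟨h, hy⟩) (by simp [h0])
      · rintro (rfl | rfl)
        · exact ⟨Or.inl rfl, hp⟩
        · exact ⟨Or.inr (Or.inl rfl), hq⟩
    refine Or.inr ⟨segment ℝ p q, ⟨p, q, hpq, rfl, hsub⟩, ?_⟩
    ext y
    constructor
    · intro hy
      exact ⟨openSegment_subset_segment ℝ p q hy, fun hL =>
        absurd (show y ∈ openSegment ℝ p q ∩ lattice d from ⟨hy, hL⟩) (by simp [h0])⟩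
    · rintro ⟨hy, hL⟩
      rw [← insert_endpoints_openSegment] at hy
      rcases hy with rfl | rfl | h
      · exact absurd hp hL
      · exact absurd hq hL
      · exact h
  · have hinj : Function.Injective (lineMap p q : ℝ → Plane) := AffineMap.lineMap_injective ℝ hpq
    have hseg : openSegment ℝ p q = lineMap p q '' Set.Ioo (0 : ℝ) 1 := by
      rw [openSegment_eq_image_lineMap]
    obtain ⟨s, hs, rfl⟩ := hseg ▸ hr
    have hseg1 : openSegment ℝ p (lineMap p q s) = lineMap p q '' Set.Ioo 0 s := by
      simpa using openSegment_lineMap p q hs.1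
    have hseg2 : openSegment ℝ (lineMap p q s) q = lineMap p q '' Set.Ioo s 1 := by
      simpa using openSegment_lineMap p q hs.2
    have hmem : ∀ {A : Set ℝ} {t : ℝ}, lineMap p q t ∈ (lineMap p q : ℝ → Plane) '' A ↔ t ∈ A :=
      hinj.mem_set_image
    have hlt : ∀ K ⊆ openSegment ℝ p q, lineMap p q s ∉ K →
        (K ∩ lattice d).ncard < n := by
      intro K hK hsK
      rw [← hn]
      refine Set.ncard_lt_ncard ⟨Set.inter_subset_inter_left _ hK, fun h => hsK ?_⟩ (hfin p q)
      exact (h ⟨hr, hrL⟩).1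
    have hne1 : p ≠ lineMap p q s := by
      conv_lhs => rw [← AffineMap.lineMap_apply_zero (k := ℝ) p q]
      exact fun h => hs.1.ne (hinj h)
    have hne2 : lineMap p q s ≠ q := by
      conv_rhs => rw [← AffineMap.lineMap_apply_one (k := ℝ) p q]
      exact fun h => hs.2.ne (hinj h)
    obtain ⟨B₁, hB₁⟩ := ih _ (hlt (openSegment ℝ p (lineMap p q s))
      (by rw [hseg1, hseg]; exact Set.image_mono (Set.Ioo_subset_Ioo_right hs.2.le))
      (by rw [hseg1, hmem]; simp)) hp hrL hne1 rfl
    obtain ⟨B₂, hB₂⟩ := ih _ (hlt (openSegment ℝ (lineMap p q s) q)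
      (by rw [hseg2, hseg]; exact Set.image_mono (Set.Ioo_subset_Ioo_left hs.1.le))
      (by rw [hseg2, hmem]; simp)) hrL hq hne2 rfl
    have h12 := hB₁.union (isCellDecomposition_point hrL)
      (Set.disjoint_singleton_right.2 (by rw [hseg1, hmem]; simp))
    have h123 := h12.union hB₂ (by
      rw [hseg1, hseg2, ← Set.image_singleton, ← Set.image_union]
      refine (Set.disjoint_image_iff hinj).2 (Set.disjoint_left.2 ?_)
      rintro t (ht | rfl) ht'
      · exact lt_asymm ht.2 ht'.1
      · exact lt_irrefl _ ht'.1)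
    refine ⟨B₁ ∪ {{lineMap p q s}} ∪ B₂, ?_⟩
    · convert h123 using 1
      rw [hseg, hseg1, hseg2, ← Set.image_singleton, ← Set.image_union, ← Set.image_union,
        Set.Ioo_union_right hs.1, Set.Ioc_union_Ioo_eq_Ioo hs.1.le hs.2]

theorem exists_isCellDecomposition_sUnion {d : ℕ} {F : Set (Set Plane)} (hF : F.Finite)
    (hdisj : F.PairwiseDisjoint id) (h : ∀ S ∈ F, ∃ B, IsCellDecomposition d B S) :
    ∃ B, IsCellDecomposition d B (⋃₀ F) := by
  induction F, hF using Set.Finite.induction_on with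
  | empty => exact ⟨∅, Set.finite_empty, by simp, by simp, by simp⟩
  | @insert S F hS _ ih =>
    obtain ⟨B, hB⟩ := ih (hdisj.subset (Set.subset_insert _ _))
      fun S' hS' => h S' (Set.mem_insert_of_mem _ hS')
    obtain ⟨B', hB'⟩ := h S (Set.mem_insert _ _)
    rw [Set.sUnion_insert]
    refine ⟨_, hB'.union hB (Set.disjoint_sUnion_right.2 fun S' hS' => ?_)⟩
    exact hdisj (Set.mem_insert _ _) (Set.mem_insert_of_mem _ hS') (by rintro rfl; exact hS hS')

/-! ### Simplices of dimension at most one as unions of cells. -/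

theorem openSimplex_zero (p : Fin 1 → Plane) : openSimplex p = {p 0} := by
  ext x
  constructor
  · rintro ⟨w, -, hw, rfl⟩
    have hw0 : w 0 = 1 := by simpa using hw
    simp [hw0]
  · rintro rfl
    exact ⟨fun _ => 1, by simp, by simp, by simp⟩

theorem openSimplex_one (p : Fin 2 → Plane) : openSimplex p = openSegment ℝ (p 0) (p 1) := by
  ext x
  constructor
  · rintro ⟨w, hw0, hw, rfl⟩
    rw [Fin.sum_univ_two] at hw
    exact ⟨w 0, w 1, hw0 0, hw0 1, hw, by simp [Fin.sum_univ_two]⟩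
  · rintro ⟨a, b, ha, hb, hab, rfl⟩
    refine ⟨![a, b], fun i => ?_, by simpa [Fin.sum_univ_two] using hab,
      by simp [Fin.sum_univ_two]⟩
    fin_cases i
    · exact ha
    · exact hb

/-- All multiples of `N` are allowed so that several simplices, and later both polygons, can share
one lattice. -/
theorem IsRationalOpenSimplex.exists_isCellDecomposition {k : ℕ} (hk : k ≤ 1) {S : Set Plane}
    (hS : IsRationalOpenSimplex k S) :
    ∃ N, 0 < N ∧ ∀ M, 0 < M → ∃ B, IsCellDecomposition (N * M) B S := by
  obtain ⟨p, hp, hr, rfl⟩ := hS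
  interval_cases k
  · obtain ⟨N, hN, h⟩ := IsRationalPoint.exists_mem_lattice (hr 0)
    rw [openSimplex_zero]
    exact ⟨N, hN, fun M hM => ⟨_, isCellDecomposition_point (mem_lattice_mul h hM)⟩⟩
  · obtain ⟨N, hN, h⟩ := IsRationalPoint.exists_mem_lattice (hr 0)
    obtain ⟨N', hN', h'⟩ := IsRationalPoint.exists_mem_lattice (hr 1)
    rw [openSimplex_one]
    refine ⟨N * N', Nat.mul_pos hN hN', fun M hM => ?_⟩
    refine exists_isCellDecomposition_openSegment (by positivity)
      (mem_lattice_mul (mem_lattice_mul h hN') hM) ?_ (hp.injective.ne (by decide))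
    rw [mul_comm N]
    exact mem_lattice_mul (mem_lattice_mul h' hN) hM

theorem exists_common_isCellDecomposition {F : Set (Set Plane)} (hF : F.Finite)
    (h : ∀ S ∈ F, ∃ N, 0 < N ∧ ∀ M, 0 < M → ∃ B, IsCellDecomposition (N * M) B S) :
    ∃ N, 0 < N ∧ ∀ M, 0 < M → ∀ S ∈ F, ∃ B, IsCellDecomposition (N * M) B S := by
  induction F, hF using Set.Finite.induction_on with
  | empty => exact ⟨1, one_pos, by simp⟩
  | @insert S F _ _ ih =>
    obtain ⟨N, hN, h1⟩ := ih fun S' hS' => h S' (Set.mem_insert_of_mem _ hS')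
    obtain ⟨N', hN', h2⟩ := h S (Set.mem_insert _ _)
    refine ⟨N * N', Nat.mul_pos hN hN', fun M hM S' hS' => ?_⟩
    rcases hS' with rfl | hS'
    · rw [mul_comm N, mul_assoc]
      exact h2 _ (Nat.mul_pos hN hM)
    · rw [mul_assoc]
      exact h1 _ (Nat.mul_pos hN' hM) S' hS'

theorem IsTriangulation.sUnion_diff {T : Set (Set Plane)} {P : Set Plane}
    (hT : IsTriangulation T P) {T' : Set (Set Plane)} (hT' : T' ⊆ T) :
    ⋃₀ (T \ T') = P \ ⋃₀ T' := by
  rw [← hT.union]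
  ext x
  constructor
  · rintro ⟨S, ⟨hS, hS'⟩, hx⟩
    refine ⟨⟨S, hS, hx⟩, ?_⟩
    rintro ⟨S', hS'', hx'⟩
    refine hS' ?_
    obtain rfl : S = S' := by
      by_contra hne
      exact Set.disjoint_left.1 (hT.disjoint hS (hT' hS'') hne) hx hx'
    exact hS''
  · rintro ⟨⟨S, hS, hx⟩, h⟩
    exact ⟨S, ⟨hS, fun h' => h ⟨S, h', hx⟩⟩, hx⟩

/-- The part of a triangulated set outside the open facets is a union of cells of a lattice. -/
theorem IsTriangulation.exists_isCellDecomposition {T : Set (Set Plane)} {P : Set Plane}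
    (hT : IsTriangulation T P) : ∃ N, 0 < N ∧ ∀ M, 0 < M →
      ∃ B, IsCellDecomposition (N * M) B (P \ ⋃₀ facets T) := by
  have hfin : (T \ facets T).Finite := hT.finite.subset Set.sdiff_subset
  obtain ⟨N, hN, h⟩ := exists_common_isCellDecomposition hfin fun S hS => by
    obtain ⟨k, hk, hS'⟩ := hT.simplex S hS.1
    refine hS'.exists_isCellDecomposition ?_
    by_contra hk1
    obtain rfl : k = 2 := by omega
    exact hS.2 ⟨hS.1, hS'⟩
  refine ⟨N, hN, fun M hM => ?_⟩
  rw [← hT.sUnion_diff (facets_subset T)]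
  exact exists_isCellDecomposition_sUnion hfin (hT.disjoint.subset Set.sdiff_subset) (h M hM)

/-! ### Matching families of sets by their orbit counts -/

/-- Disjointness is required only inside `X`: boundary segments share endpoints, but no generic
points. -/
theorem ncard_inter_sUnion {B : Set (Set Plane)} (hB : B.Finite) {X : Set Plane}
    (hfin : ∀ S ∈ B, (X ∩ S).Finite) (hdisj : B.PairwiseDisjoint fun S => X ∩ S) :
    (X ∩ ⋃₀ B).ncard = ∑ S ∈ hB.toFinset, (X ∩ S).ncard := by
  induction B, hB using Set.Finite.induction_on with
  | empty => simp
  | @insert S B hS hB ih =>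
    rw [Set.sUnion_insert, Set.inter_union_distrib_left]
    have hU : X ∩ ⋃₀ B = ⋃ S ∈ B, X ∩ S := by rw [Set.sUnion_eq_biUnion, Set.inter_iUnion₂]
    have h1 : Disjoint (X ∩ S) (X ∩ ⋃₀ B) := by
      rw [hU]
      refine Set.disjoint_iUnion₂_right.2 fun S' hS' => ?_
      exact hdisj (Set.mem_insert _ _) (Set.mem_insert_of_mem _ hS') (by rintro rfl; exact hS hS')
    have h2 : (X ∩ ⋃₀ B).Finite := by
      rw [hU]
      exact hB.biUnion fun S' hS' => hfin S' (Set.mem_insert_of_mem _ hS')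
    rw [Set.ncard_union_eq h1 (hfin S (Set.mem_insert _ _)) h2,
      ih (fun S' hS' => hfin S' (Set.mem_insert_of_mem _ hS'))
      (hdisj.subset (Set.subset_insert _ _)), Set.Finite.toFinset_insert,
      Finset.sum_insert (by simpa using hS)]

/-- The `G`-equivalence class of a set. -/
def gClass (S : Set Plane) : Set (Set Plane) := {S' | GEquivalent S S'}

theorem gClass_eq_iff {S S' : Set Plane} : gClass S = gClass S' ↔ GEquivalent S S' := by
  constructor
  · intro h
    have : S' ∈ gClass S := h ▸ GEquivalent.refl S'
    exact this
  · intro h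
    ext S''
    exact ⟨fun h' => h.symm.trans h', fun h' => h.trans h'⟩

/-- `X` meets only members equivalent to `S`, each in `|X ∩ S|` points. Both sums are therefore the
multiplicity of the class times this number, which is positive and cancels. -/
theorem map_gClass_eq_map_gClass {B₁ B₂ : Finset (Set Plane)}
    (h : ∀ S, S ∈ B₁ ∨ S ∈ B₂ → ∃ X, IsGInvariant X ∧ (X ∩ S).Finite ∧ (X ∩ S).Nonempty ∧
      (∀ S', S' ∈ B₁ ∨ S' ∈ B₂ → (X ∩ S').Nonempty → GEquivalent S S') ∧
      ∑ S' ∈ B₁, (X ∩ S').ncard = ∑ S' ∈ B₂, (X ∩ S').ncard) :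
    B₁.val.map gClass = B₂.val.map gClass := by
  classical
  ext c
  rw [Multiset.count_map, Multiset.count_map]
  by_cases hc : ∃ S, (S ∈ B₁ ∨ S ∈ B₂) ∧ c = gClass S
  · obtain ⟨S, hS, rfl⟩ := hc
    obtain ⟨X, hX, hfin, hne, honly, hsum⟩ := h S hS
    have key : ∀ B : Finset (Set Plane), (∀ S' ∈ B, S' ∈ B₁ ∨ S' ∈ B₂) →
        ∑ S' ∈ B, (X ∩ S').ncard =
          (B.val.filter fun a => gClass S = gClass a).card * (X ∩ S).ncard := by
      intro B hB
      rw [← Finset.filter_val, Finset.card_val, ← smul_eq_mul, ← Finset.sum_const,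
        Finset.sum_filter]
      refine Finset.sum_congr rfl fun S' hS' => ?_
      split_ifs with h
      · exact (gClass_eq_iff.1 h).ncard_inter hX
      · have : X ∩ S' = ∅ := by
          by_contra hne'
          exact h (gClass_eq_iff.2 (honly S' (hB S' hS') (Set.nonempty_iff_ne_empty.2 hne')))
        rw [this, Set.ncard_empty]
    rw [key B₁ fun _ => Or.inl, key B₂ fun _ => Or.inr] at hsum
    exact Nat.eq_of_mul_eq_mul_right ((Set.ncard_pos hfin).2 hne) hsum
  · push Not at hc
    rw [Multiset.filter_eq_nil.2 fun S hS => hc S (Or.inl hS),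
      Multiset.filter_eq_nil.2 fun S hS => hc S (Or.inr hS)]

theorem exists_bijOn_of_map_eq {α β : Type*} {s t : Finset α} {f : α → β}
    (h : s.val.map f = t.val.map f) : ∃ φ : α → α, Set.BijOn φ s t ∧ ∀ a ∈ s, f (φ a) = f a := by
  classical
  have hcard : ∀ c, Fintype.card {a : s // f a = c} = Fintype.card {a : t // f a = c} := by
    have key : ∀ (s : Finset α) (c : β),
        Fintype.card {a : s // f a = c} = (s.val.map f).count c := by
      intro s c
      rw [Multiset.count_map, ← Finset.filter_val, Finset.card_val, Fintype.card_subtype,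
        ← Finset.card_map (Function.Embedding.subtype (· ∈ s))]
      congr 1
      ext a
      simp [eq_comm, and_comm]
    intro c
    rw [key, key, h]
  let e : s ≃ t := Equiv.ofFiberEquiv (f := fun a : s => f a) (g := fun a : t => f a)
    fun c => Fintype.equivOfCardEq (hcard c)
  have he : ∀ a, f (e a) = f a := fun a =>
    Equiv.ofFiberEquiv_map (f := fun a : s => f a) (g := fun a : t => f a) _ a
  refine ⟨fun a => if ha : a ∈ s then e ⟨a, ha⟩ else a, ⟨fun a ha => ?_, fun a ha b hb hab => ?_,
    fun b hb => ?_⟩, fun a ha => ?_⟩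
  · have ha' : a ∈ s := ha
    simp [ha']
  · have ha' : a ∈ s := ha
    have hb' : b ∈ s := hb
    simp only [ha', hb', dif_pos] at hab
    simpa using e.injective (Subtype.ext hab)
  · refine ⟨e.symm ⟨b, hb⟩, (e.symm ⟨b, hb⟩).2, ?_⟩
    simp
  · simp [ha, he]

/-! ### Gluing -/

theorem exists_isEquidecomposabilityRelation {T T' : Set (Set Plane)} {P Q : Set Plane}
    (hT : IsTriangulation T P) (hT' : IsTriangulation T' Q) {φ : Set Plane → Set Plane}
    (hφ : Set.BijOn φ T T') {g : Set Plane → Plane → Plane} (hg : ∀ S ∈ T, IsGMap (g S))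
    (hφg : ∀ S ∈ T, g S '' S = φ S) :
    ∃ F, IsEquidecomposabilityRelation P Q F ∧ ∀ S ∈ T, Set.EqOn F (g S) S := by
  classical
  -- The value outside the pieces is irrelevant; inside, disjointness makes the chosen piece unique.
  let F : Plane → Plane := fun x => if h : ∃ S ∈ T, x ∈ S then g h.choose x else x
  have hF : ∀ S ∈ T, Set.EqOn F (g S) S := by
    intro S hS x hx
    have h : ∃ S ∈ T, x ∈ S := ⟨S, hS, hx⟩
    have hS' : h.choose = S := by
      by_contra hne
      exact Set.disjoint_left.1 (hT.disjoint h.choose_spec.1 hS hne) h.choose_spec.2 hx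
    simp only [F, dif_pos h, hS']
  have himg : ∀ S ∈ T, F '' S = φ S := fun S hS => (hF S hS).image_eq.trans (hφg S hS)
  refine ⟨F, ⟨T, hT, fun S hS => ⟨g S, hg S hS, hF S hS⟩, fun S hS S' hS' hne => ?_, ?_⟩, hF⟩
  · show Disjoint (F '' S) (F '' S')
    rw [himg S hS, himg S' hS']
    exact hT'.disjoint (hφ.mapsTo hS) (hφ.mapsTo hS') fun h => hne (hφ.injOn hS hS' h)
  · rw [← hT'.union, ← hφ.image_eq, Set.sUnion_image]
    exact Set.iUnion₂_congr himg

/-! ### The boundary of a polygon -/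

theorem HasDenominator.pos {P : Set Plane} {d : ℕ} (h : HasDenominator P d) : 0 < d := h.1.1

theorem HasDenominator.exists_local_line {P : Set Plane} {d : ℕ} (h : HasDenominator P d)
    {x : Plane} (hx : x ∈ frontier P) (hxd : x ∉ lattice d) :
    ∃ U ∈ 𝓝 x, ∃ u : Plane, u ≠ 0 ∧ frontier P ∩ U = {y | ∃ s : ℝ, y = x + s • u} ∩ U := by
  by_contra hne
  exact hxd (h.1.2 x ⟨hx, hne⟩)

/-- Following the boundary along a straight line, one reaches a point of `𝓛_d`. -/
theorem HasDenominator.exists_lattice_on_ray {P : Set Plane} (hP : IsPolygon P) {d : ℕ}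
    (h : HasDenominator P d) {x u : Plane} (hu : u ≠ 0)
    (hloc : ∀ᶠ s : ℝ in 𝓝 0, x + s • u ∈ frontier P) :
    ∃ t : ℝ, 0 < t ∧ x + t • u ∈ lattice d ∧ ∀ s, 0 ≤ s → s ≤ t → x + s • u ∈ frontier P := by
  have hcont : Continuous fun s : ℝ => x + s • u := by fun_prop
  obtain ⟨ε, hε, hball⟩ := Metric.eventually_nhds_iff.1 hloc
  have hε' : ∀ s : ℝ, |s| < ε → x + s • u ∈ frontier P := fun s hs =>
    hball (by simpa [Real.dist_eq] using hs)
  let A : Set ℝ := {s | 0 ≤ s ∧ x + s • u ∉ frontier P}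
  have hA : A.Nonempty := by
    obtain ⟨R, hR⟩ := hP.isCompact.isBounded.exists_norm_le
    have hu' : 0 < ‖u‖ := norm_pos_iff.2 hu
    have hR0 : 0 ≤ |R| + ‖x‖ + 1 := by positivity
    refine ⟨(|R| + ‖x‖ + 1) / ‖u‖, by positivity, fun hmem => ?_⟩
    have h1 := hR _ (hP.isCompact.isClosed.frontier_subset hmem)
    have h2 : ‖((|R| + ‖x‖ + 1) / ‖u‖) • u‖ = |R| + ‖x‖ + 1 := by
      rw [norm_smul, Real.norm_of_nonneg (by positivity), div_mul_cancel₀ _ hu'.ne']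
    have h3 := norm_sub_le (x + ((|R| + ‖x‖ + 1) / ‖u‖) • u) x
    rw [add_sub_cancel_left, h2] at h3
    linarith [le_abs_self R]
  have hbdd : BddBelow A := ⟨0, fun s hs => hs.1⟩
  -- `t` is the first exit time of the ray from the boundary.
  set t := sInf A with ht
  have ht0 : 0 < t := by
    refine lt_of_lt_of_le hε (le_csInf hA fun s hs => ?_)
    by_contra hlt
    exact hs.2 (hε' s (by rw [abs_of_nonneg hs.1]; linarith))
  have hlt : ∀ s, 0 ≤ s → s < t → x + s • u ∈ frontier P := by
    intro s hs0 hst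
    by_contra hn
    exact absurd (csInf_le hbdd (show s ∈ A from ⟨hs0, hn⟩)) (not_le.2 hst)
  have hleft : ∀ᶠ s : ℝ in 𝓝[<] t, x + s • u ∈ frontier P := by
    filter_upwards [Ioo_mem_nhdsLT ht0] with s hs
    exact hlt s hs.1.le hs.2
  have htfr : x + t • u ∈ frontier P :=
    isClosed_frontier.mem_of_tendsto (hcont.continuousAt.mono_left nhdsWithin_le_nhds) hleft
  refine ⟨t, ht0, ?_, fun s hs0 hst => ?_⟩
  · by_contra hn
    -- Off the lattice the exit point is no vertex, so the boundary is straight there. It contains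
    -- points of the ray before `t`, so it is parallel to `u` and continues past `t`, a
    -- contradiction.
    obtain ⟨U, hU, w, hw, heq⟩ := h.exists_local_line htfr hn
    have hUt : ∀ᶠ s : ℝ in 𝓝 t, x + s • u ∈ U := hcont.continuousAt.eventually hU
    obtain ⟨s, ⟨hs1, hs2⟩, hs3⟩ :=
      ((hleft.and (hUt.filter_mono nhdsWithin_le_nhds)).and self_mem_nhdsWithin).exists
    have hs4 : x + s • u ∈ frontier P ∩ U := ⟨hs1, hs2⟩
    rw [heq] at hs4
    obtain ⟨⟨r, hr⟩, -⟩ := hs4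
    have hst : s - t ≠ 0 := sub_ne_zero.2 (ne_of_lt hs3)
    have huw : u = (r / (s - t)) • w := by
      have h1 : (s - t) • u = r • w := by
        rw [sub_smul, sub_eq_iff_eq_add]
        have := hr
        rw [add_assoc, add_right_inj] at this
        rw [this, add_comm]
      rw [div_eq_inv_mul, mul_smul, ← h1, smul_smul, inv_mul_cancel₀ hst, one_smul]
    obtain ⟨δ, hδ, hball'⟩ := Metric.eventually_nhds_iff.1 hUt
    have h2 : ∀ s' ∈ A, t + δ ≤ s' := by
      intro s' hs'
      by_contra hlt'
      refine hs'.2 ?_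
      have h3 : x + s' • u ∈ U := hball' (by
        rw [Real.dist_eq, abs_of_nonneg] <;> linarith [csInf_le hbdd hs'])
      have h4 : x + s' • u ∈ {y | ∃ r : ℝ, y = x + t • u + r • w} ∩ U := by
        refine ⟨⟨(s' - t) * (r / (s - t)), ?_⟩, h3⟩
        rw [mul_smul, ← huw, add_assoc, ← add_smul]
        congr 2
        ring
      rw [← heq] at h4
      exact h4.1
    linarith [le_csInf hA h2]
  · rcases hst.lt_or_eq with hst | rfl
    · exact hlt s hs0 hst
    · exact htfr

/-- Following the boundary both ways from `x` gives a segment with endpoints in `𝓛_d`; the cell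
containing `x` is the required minimal segment without its endpoints. -/
theorem HasDenominator.exists_mem_boundarySegments {P : Set Plane} (hP : IsPolygon P) {d : ℕ}
    (h : HasDenominator P d) {x : Plane} (hx : x ∈ frontier P) (hxd : x ∉ lattice d) :
    ∃ E ∈ boundarySegments d P, x ∈ E := by
  obtain ⟨U, hU, u, hu, heq⟩ := h.exists_local_line hx hxd
  have hloc : ∀ᶠ s : ℝ in 𝓝 0, x + s • u ∈ frontier P := by
    have hcont : ContinuousAt (fun s : ℝ => x + s • u) 0 := by fun_prop
    have : ∀ᶠ s : ℝ in 𝓝 0, x + s • u ∈ U := hcont.eventually (by simpa using hU)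
    filter_upwards [this] with s hs
    have h1 : x + s • u ∈ {y | ∃ s : ℝ, y = x + s • u} ∩ U := ⟨⟨s, rfl⟩, hs⟩
    rw [← heq] at h1
    exact h1.1
  have hloc' : ∀ᶠ s : ℝ in 𝓝 0, x + s • (-u) ∈ frontier P := by
    have : Filter.Tendsto (fun s : ℝ => -s) (𝓝 0) (𝓝 0) := by
      simpa using (continuous_neg (G := ℝ)).tendsto 0
    filter_upwards [this.eventually hloc] with s hs
    simpa using hs
  obtain ⟨t, ht, hq, htf⟩ := h.exists_lattice_on_ray hP hu hloc
  obtain ⟨t', ht', hp, htf'⟩ := h.exists_lattice_on_ray hP (neg_ne_zero.2 hu) hloc'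
  set p := x + t' • -u with hpdef
  set q := x + t • u with hqdef
  have hpq : p ≠ q := by
    intro hpq
    rw [hpdef, hqdef, add_right_inj, smul_neg, ← neg_smul, ← sub_eq_zero, ← sub_smul] at hpq
    rcases smul_eq_zero.1 hpq with h | h
    · linarith
    · exact hu h
  have hsub : openSegment ℝ p q ⊆ frontier P := by
    rintro _ ⟨a, b, ha, hb, hab, rfl⟩
    have h1 : a • p + b • q = x + (b * t - a * t') • u := by
      obtain rfl : a = 1 - b := by linarith
      rw [hpdef, hqdef]
      module
    rw [h1]
    rcases le_total 0 (b * t - a * t') with h0 | h0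
    · exact htf _ h0 (by nlinarith)
    · have h2 := htf' (-(b * t - a * t')) (by linarith) (by nlinarith)
      rwa [smul_neg, neg_smul, neg_neg] at h2
  have hxpq : x ∈ openSegment ℝ p q := by
    refine ⟨t / (t + t'), t' / (t + t'), by positivity, by positivity, ?_, ?_⟩
    · field_simp
    · rw [hpdef, hqdef]
      have h1 : t / (t + t') + t' / (t + t') = 1 := by field_simp
      have h2 : t / (t + t') * t' = t' / (t + t') * t := by ring
      calc _ = (t / (t + t') + t' / (t + t')) • x +
            (t' / (t + t') * t - t / (t + t') * t') • u := by module
        _ = x := by rw [h1, h2, sub_self, zero_smul, one_smul, add_zero]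
  obtain ⟨B, -, hB, -, hU⟩ := exists_isCellDecomposition_openSegment h.pos hp hq hpq
  rw [← hU] at hxpq hsub
  obtain ⟨S, hS, hxS⟩ := hxpq
  rcases hB S hS with ⟨p', hp', rfl⟩ | ⟨E, hE, rfl⟩
  · exact absurd (Set.mem_singleton_iff.1 hxS ▸ hp') hxd
  · refine ⟨E, ⟨hE, ?_⟩, hxS.1⟩
    have hES : E \ lattice d ⊆ frontier P := (Set.subset_sUnion_of_mem hS).trans hsub
    obtain ⟨p', q', hpq', rfl, hL⟩ := hE
    rw [← closure_openSegment]
    refine closure_minimal (Set.Subset.trans (fun y hy => ?_) hES) isClosed_frontier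
    have hys := openSegment_subset_segment ℝ p' q' hy
    refine ⟨hys, fun hyL => ?_⟩
    have h1 : y ∈ ({p', q'} : Set Plane) := hL ▸ ⟨hys, hyL⟩
    rcases h1 with rfl | rfl
    · exact hpq' (left_mem_openSegment_iff.1 hy)
    · exact hpq' (right_mem_openSegment_iff.1 hy)

theorem not_mem_lattice_of_mem_gOrbit {d : ℕ} {x y : Plane} (hx : IsGeneric x)
    (hy : y ∈ gOrbit x) : y ∉ lattice d := fun h =>
  (isGInvariant_isGeneric.gOrbit_subset hx hy).not_isRationalPoint
    (isRationalPoint_of_mem_lattice h)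

theorem HasDenominator.ncard_gOrbit_inter_frontier {P : Set Plane} (hP : IsPolygon P) {d : ℕ}
    (h : HasDenominator P d) {x : Plane} (hx : IsGeneric x) :
    (gOrbit x ∩ frontier P).ncard =
      ∑ E ∈ (hP.finite_boundarySegments h.pos).toFinset, (gOrbit x ∩ E).ncard := by
  rw [← ncard_inter_sUnion]
  · congr 1
    ext y
    constructor
    · rintro ⟨hy, hyP⟩
      obtain ⟨E, hE, hyE⟩ := h.exists_mem_boundarySegments hP hyP
        (not_mem_lattice_of_mem_gOrbit hx hy)
      exact ⟨hy, E, hE, hyE⟩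
    · rintro ⟨hy, E, hE, hyE⟩
      exact ⟨hy, hE.2 hyE⟩
  · exact fun E hE => hE.1.finite_gOrbit_inter h.pos hx
  · intro E hE E' hE' hne
    refine Set.disjoint_left.2 fun y hy hy' => hne ?_
    exact hE.1.eq_of_mem hE'.1 (isGInvariant_isGeneric.gOrbit_subset hx hy.1) hy.2 hy'.2

/-! ### Weights -/

theorem orientedWeight_eq (d : ℕ) (a b : Fin 2 → ℤ) :
    orientedWeight d a b = (a 0 : ZMod d) * b 1 - b 0 * a 1 := by
  simp [orientedWeight, Matrix.det_fin_two]

theorem orientedWeight_affine (d : ℕ) (U : Matrix (Fin 2) (Fin 2) ℤ) (v a b : Fin 2 → ℤ) :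
    orientedWeight d (U *ᵥ a + (d : ℤ) • v) (U *ᵥ b + (d : ℤ) • v) =
      (U.det : ZMod d) * orientedWeight d a b := by
  simp only [orientedWeight_eq, Matrix.det_fin_two, Matrix.mulVec, dotProduct, Fin.sum_univ_two,
    Pi.add_apply, Pi.smul_apply, smul_eq_mul]
  push_cast
  rw [ZMod.natCast_self]
  ring

theorem GEquivalent.segmentWeight_fst_subset {d : ℕ} (hd : 0 < d) {E E' : Set Plane}
    (h : GEquivalent E E') : (segmentWeight d E).1 ⊆ (segmentWeight d E').1 := by
  rintro w ⟨a, b, hE, rfl⟩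
  obtain ⟨g, hg, rfl⟩ := h
  rw [hE, hg.image_segment]
  obtain ⟨U, v, rfl⟩ := hg
  rw [affineUnimodular_latticePoint hd, affineUnimodular_latticePoint hd]
  have hdet : U.1.det = 1 ∨ U.1.det = -1 :=
    Int.isUnit_iff.1 ((Matrix.isUnit_iff_isUnit_det _).1 U.isUnit)
  rcases hdet with hdet | hdet
  · exact ⟨_, _, rfl, by rw [orientedWeight_affine, hdet]; simp⟩
  -- Determinant `-1` changes the sign of the weight; reversing the segment restores it.
  · refine ⟨_, _, segment_symm _ _ _, ?_⟩
    rw [orientedWeight_affine, hdet, orientedWeight_eq, orientedWeight_eq]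
    push_cast
    ring

/-- The entry `± i` is a `G`-invariant, so it is already determined by the class. -/
theorem segmentWeight_eq_iff {d : ℕ} (hd : 0 < d) {E E' : Set Plane} :
    segmentWeight d E = segmentWeight d E' ↔ gClass E = gClass E' := by
  refine ⟨fun h => congrArg Prod.snd h, fun h => Prod.ext ?_ h⟩
  have h' := gClass_eq_iff.1 h
  exact (h'.segmentWeight_fst_subset hd).antisymm (h'.symm.segmentWeight_fst_subset hd)

theorem map_eq_map_of_factors {α β γ : Type*} {s t : Multiset α} {f : α → β} {g : α → γ}
    (h : ∀ a b, f a = f b → g a = g b) (hst : s.map f = t.map f) : s.map g = t.map g := by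
  rcases isEmpty_or_nonempty γ with hγ | ⟨⟨c⟩⟩
  · have hα : IsEmpty α := ⟨fun a => hγ.elim (g a)⟩
    rw [s.eq_zero_of_forall_notMem fun a => hα.elim a,
      t.eq_zero_of_forall_notMem fun a => hα.elim a]
  have hfac : g = Function.extend f g (fun _ => c) ∘ f := by
    funext a
    exact (Function.FactorsThrough.extend_apply (fun a b => h a b) _ a).symm
  rw [hfac, ← Multiset.map_map, hst, Multiset.map_map]

/-- Equality of Weights means that the boundaries contain the same number of points of every
generic orbit. -/
theorem polygonWeight_eq_iff {P Q : Set Plane} (hP : IsPolygon P) (hQ : IsPolygon Q) {d : ℕ}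
    (hPd : HasDenominator P d) (hQd : HasDenominator Q d) :
    polygonWeight d P = polygonWeight d Q ↔ ∀ x, IsGeneric x →
      (gOrbit x ∩ frontier P).ncard = (gOrbit x ∩ frontier Q).ncard := by
  have hd := hPd.pos
  rw [hP.polygonWeight_eq hd, hQ.polygonWeight_eq hd]
  constructor
  · intro h x hx
    have h' := map_eq_map_of_factors (g := fun E => (gOrbit x ∩ E).ncard)
      (fun E E' hEE' => ((gClass_eq_iff.1 ((segmentWeight_eq_iff hd).1 hEE')).ncard_inter
        (isGInvariant_gOrbit x)).symm) h
    rw [hPd.ncard_gOrbit_inter_frontier hP hx, hQd.ncard_gOrbit_inter_frontier hQ hx]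
    exact congrArg Multiset.sum h'
  · intro h
    refine map_eq_map_of_factors (f := gClass)
      (fun E E' => (segmentWeight_eq_iff hd).2) (map_gClass_eq_map_gClass fun E hE => ?_)
    have hmin : ∀ E, E ∈ (hP.finite_boundarySegments hd).toFinset ∨
        E ∈ (hQ.finite_boundarySegments hd).toFinset → IsMinimalSegment d E := by
      intro E hE
      rw [Set.Finite.mem_toFinset, Set.Finite.mem_toFinset] at hE
      exact hE.elim And.left And.left
    obtain ⟨x, hxE, hx⟩ := (hmin E hE).exists_isGeneric
    refine ⟨gOrbit x, isGInvariant_gOrbit x, (hmin E hE).finite_gOrbit_inter hd hx,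
      ⟨x, mem_gOrbit_self x, hxE⟩, ?_, ?_⟩
    · rintro E' hE' ⟨y, ⟨g, hg, rfl⟩, hy⟩
      exact ⟨g, hg, (hmin E hE).eq_image hd (hmin E' hE') hx hxE hg hy⟩
    · rw [← hPd.ncard_gOrbit_inter_frontier hP hx, ← hQd.ncard_gOrbit_inter_frontier hQ hx, h x hx]

/-! ### The Ehrhart function and the orbits of rational points -/

theorem ehr_eq_ncard (S : Set Plane) {t : ℕ} (ht : 0 < t) : ehr S t = (lattice t ∩ S).ncard := by
  have ht' : (t : ℝ) ≠ 0 := by positivity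
  have hinj : Function.Injective fun x : Plane => (t : ℝ) • x := smul_right_injective _ ht'
  rw [ehr, ← Set.ncard_image_of_injective (lattice t ∩ S) hinj]
  have hlat : ∀ x : Plane, (t : ℝ) • x ∈ lattice 1 ↔ x ∈ lattice t := by
    intro x
    constructor
    · rintro ⟨a, ha⟩
      refine ⟨a, funext fun i => ?_⟩
      have := congrFun ha i
      simp only [latticePoint, Nat.cast_one, div_one, Pi.smul_apply, smul_eq_mul] at this ⊢
      rw [this, mul_div_cancel_left₀ _ ht']
    · rintro ⟨a, rfl⟩
      refine ⟨a, funext fun i => ?_⟩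
      simp only [latticePoint, Nat.cast_one, div_one, Pi.smul_apply, smul_eq_mul]
      rw [mul_div_cancel₀ _ ht']
  congr 1
  ext y
  constructor
  · rintro ⟨⟨x, hx, rfl⟩, hy⟩
    exact ⟨x, ⟨(hlat x).1 hy, hx⟩, rfl⟩
  · rintro ⟨x, ⟨h1, h2⟩, rfl⟩
    exact ⟨⟨x, h2, rfl⟩, (hlat x).2 h1⟩

/-- By Bézout, `gcd · x` is an integral combination of the integral vectors `m x` and `n x`. -/
theorem mem_lattice_gcd {m n : ℕ} (hm : 0 < m) (hn : 0 < n) {x : Plane} (hxm : x ∈ lattice m)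
    (hxn : x ∈ lattice n) : x ∈ lattice (m.gcd n) := by
  obtain ⟨a, rfl⟩ := hxm
  obtain ⟨b, hb⟩ := hxn
  have hm' : (m : ℝ) ≠ 0 := by positivity
  have hn' : (n : ℝ) ≠ 0 := by positivity
  have hg : ((m.gcd n : ℕ) : ℝ) ≠ 0 := by
    have := Nat.gcd_pos_of_pos_left n hm
    positivity
  have hbez : ((m.gcd n : ℕ) : ℝ) = m * (m.gcdA n : ℤ) + n * (m.gcdB n : ℤ) := by
    exact_mod_cast Nat.gcd_eq_gcd_ab m n
  refine ⟨fun i => a i * m.gcdA n + b i * m.gcdB n, funext fun i => ?_⟩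
  have h := congrFun hb i
  simp only [latticePoint] at h ⊢
  rw [div_eq_iff hg, hbez]
  push_cast
  rw [div_eq_div_iff hn' hm'] at h
  field_simp
  linear_combination (m.gcdB n : ℝ) * h

/-- The least positive integer `k` such that `x` lies in `𝓛_k`. -/
def denominator (x : Plane) : ℕ := sInf {k | 0 < k ∧ x ∈ lattice k}

theorem denominator_spec {x : Plane} (hx : IsRationalPoint x) :
    0 < denominator x ∧ x ∈ lattice (denominator x) :=
  Nat.sInf_mem (s := {k | 0 < k ∧ x ∈ lattice k}) hx.exists_mem_lattice

theorem denominator_le {x : Plane} {k : ℕ} (hk : 0 < k) (hx : x ∈ lattice k) :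
    denominator x ≤ k := Nat.sInf_le ⟨hk, hx⟩

theorem denominator_dvd {x : Plane} {t : ℕ} (ht : 0 < t) (hx : x ∈ lattice t) :
    denominator x ∣ t := by
  obtain ⟨h0, h1⟩ := denominator_spec (isRationalPoint_of_mem_lattice hx)
  have h2 := denominator_le (Nat.gcd_pos_of_pos_left t h0) (mem_lattice_gcd h0 ht h1 hx)
  exact Nat.gcd_eq_left_iff_dvd.1 (le_antisymm (Nat.gcd_le_left _ h0) h2)

theorem denominator_apply {g : Plane → Plane} (hg : IsGMap g) (x : Plane) :
    denominator (g x) = denominator x := by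
  unfold denominator
  congr 1
  ext k
  simp only [Set.mem_ofPred_eq]
  exact and_congr_right fun hk => (isGInvariant_lattice hk).apply_mem_iff hg

theorem exists_mulVec_eq_gcd (a : Fin 2 → ℤ) :
    ∃ U : GL (Fin 2) ℤ, U.1 *ᵥ a = ![((a 0).gcd (a 1) : ℤ), 0] := by
  by_cases hg : (a 0).gcd (a 1) = 0
  · rw [Int.gcd_eq_zero_iff] at hg
    refine ⟨1, funext fun i => ?_⟩
    fin_cases i <;> simp [hg.1, hg.2]
  · obtain ⟨p, hp⟩ := Int.gcd_dvd_left (a 0) (a 1)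
    obtain ⟨q, hq⟩ := Int.gcd_dvd_right (a 0) (a 1)
    have hbez := Int.gcd_eq_gcd_ab (a 0) (a 1)
    set g : ℤ := ((a 0).gcd (a 1) : ℤ) with hgdef
    have hg' : g ≠ 0 := by rw [hgdef]; exact_mod_cast hg
    set s := (a 0).gcdA (a 1)
    set t := (a 0).gcdB (a 1)
    have h1 : p * s + q * t = 1 := by
      apply mul_left_cancel₀ hg'
      linear_combination -hbez - s * hp - t * hq
    -- Since `a = g (p, q)`, the Bézout row sends `a` to `g` and the row `(-q, p)` kills it.
    let M : Matrix (Fin 2) (Fin 2) ℤ := !![s, t; -q, p]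
    have hM : M.det = 1 := by
      simp only [M, Matrix.det_fin_two_of]
      linear_combination h1
    refine ⟨Matrix.GeneralLinearGroup.mk'' M (by rw [hM]; exact isUnit_one), funext fun i => ?_⟩
    show (M *ᵥ a) i = _
    fin_cases i
    · simp [M, Matrix.mulVec, dotProduct, Fin.sum_univ_two]
      linear_combination -hbez
    · simp [M, Matrix.mulVec, dotProduct, Fin.sum_univ_two]
      linear_combination (-q) * hp + p * hq

/-- All rational points of the same denominator are `G`-equivalent. -/
theorem latticePoint_mem_gOrbit {x : Plane} (hx : IsRationalPoint x) :
    latticePoint (denominator x) ![1, 0] ∈ gOrbit x := by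
  obtain ⟨hk, a, ha⟩ := denominator_spec hx
  set k := denominator x with hkdef
  obtain ⟨U, hU⟩ := exists_mulVec_eq_gcd a
  set g := (a 0).gcd (a 1) with hg
  -- `U` brings the numerators to `(g, 0)`, and translation by `(0, 1)` turns them into `(g, k)`.
  -- These are coprime, a common factor contradicting minimality of `k`, so `U'` reaches `(1, 0)`.
  obtain ⟨U', hU'⟩ := exists_mulVec_eq_gcd ![(g : ℤ), k]
  have hcop : g.gcd k = 1 := by
    have hc0 : 0 < g.gcd k := Nat.gcd_pos_of_pos_right _ hk
    obtain ⟨m, hm⟩ := Nat.gcd_dvd_right g k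
    have hm0 : 0 < m := Nat.pos_of_ne_zero (by rintro rfl; omega)
    have hdvd : ∀ i, ((g.gcd k : ℕ) : ℤ) ∣ a i := by
      intro i
      refine (Int.natCast_dvd_natCast.2 (Nat.gcd_dvd_left g k)).trans ?_
      fin_cases i
      · exact Int.gcd_dvd_left _ _
      · exact Int.gcd_dvd_right _ _
    choose b hb using hdvd
    have hxm : x ∈ lattice m := by
      refine ⟨b, ?_⟩
      rw [← ha]
      funext i
      have hc' : ((g.gcd k : ℕ) : ℝ) ≠ 0 := by positivity
      have hkr : (k : ℝ) = (g.gcd k : ℕ) * m := by exact_mod_cast hm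
      have har : (a i : ℝ) = (g.gcd k : ℕ) * b i := by exact_mod_cast hb i
      simp only [latticePoint]
      rw [hkr, har, mul_div_mul_left _ _ hc']
    have h1 : k ≤ m := denominator_le hm0 hxm
    have h2 : g.gcd k * m ≤ 1 * m := by omega
    have := Nat.le_of_mul_le_mul_right h2 hm0
    omega
  have h1 : latticePoint k ![(g : ℤ), k] ∈ gOrbit x := by
    refine ⟨affineUnimodular U ![0, 1], ⟨U, _, rfl⟩, ?_⟩
    rw [← ha, affineUnimodular_latticePoint hk, hU]
    congr 1
    ext i
    fin_cases i <;> simp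
  have h2 : latticePoint k ![1, 0] ∈ gOrbit (latticePoint k ![(g : ℤ), k]) := by
    refine ⟨affineUnimodular U' 0, ⟨U', _, rfl⟩, ?_⟩
    rw [affineUnimodular_latticePoint hk, hU']
    have : (((g : ℤ)).gcd (k : ℤ)) = 1 := by rw [Int.gcd_natCast_natCast, hcop]
    congr 1
    ext i
    fin_cases i <;> simp [this]
  rwa [gOrbit_eq h1] at h2

theorem gOrbit_eq_denominator {x : Plane} (hx : IsRationalPoint x) :
    gOrbit x = {y | IsRationalPoint y ∧ denominator y = denominator x} := by
  ext y
  constructor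
  · rintro ⟨g, hg, rfl⟩
    exact ⟨isGInvariant_isRationalPoint g hg x hx, denominator_apply hg x⟩
  · rintro ⟨hy, he⟩
    have h1 := latticePoint_mem_gOrbit hy
    rw [he] at h1
    rw [← gOrbit_eq (latticePoint_mem_gOrbit hx), gOrbit_eq h1]
    exact mem_gOrbit_self y

theorem ncard_lattice_inter {P : Set Plane} (hP : IsCompact P) {t : ℕ} (ht : 0 < t) :
    (lattice t ∩ P).ncard = ∑ k ∈ t.divisors,
      ({y | IsRationalPoint y ∧ denominator y = k} ∩ P).ncard := by
  classical
  have hfin := finite_lattice_inter ht hP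
  rw [Set.inter_comm, Set.ncard_eq_toFinset_card _ hfin,
    Finset.card_eq_sum_card_fiberwise (f := denominator) (t := t.divisors)]
  · refine Finset.sum_congr rfl fun k hk => ?_
    rw [← Set.ncard_coe_finset]
    congr 1
    ext y
    simp only [Finset.coe_filter, Set.Finite.mem_toFinset, Set.mem_inter_iff, Set.mem_ofPred_eq]
    constructor
    · rintro ⟨⟨h1, h2⟩, h3⟩
      exact ⟨⟨isRationalPoint_of_mem_lattice h2, h3⟩, h1⟩
    · rintro ⟨⟨h1, rfl⟩, h3⟩
      refine ⟨⟨h3, ?_⟩, rfl⟩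
      obtain ⟨m, rfl⟩ := Nat.dvd_of_mem_divisors hk
      exact mem_lattice_mul (denominator_spec h1).2 (Nat.pos_of_mul_pos_left ht)
  · intro y hy
    have hy' := (hfin.mem_toFinset.1 hy).2
    exact Nat.mem_divisors.2 ⟨denominator_dvd ht hy', ht.ne'⟩

/-- The Ehrhart function determines how many points of each orbit of rational points lie in a
compact set. -/
theorem ncard_gOrbit_inter_eq_of_ehr_eq {P Q : Set Plane} (hP : IsCompact P) (hQ : IsCompact Q)
    (h : ehr P = ehr Q) {x : Plane} (hx : IsRationalPoint x) :
    (gOrbit x ∩ P).ncard = (gOrbit x ∩ Q).ncard := by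
  rw [gOrbit_eq_denominator hx]
  have hpos := (denominator_spec hx).1
  generalize denominator x = t at hpos ⊢
  -- The counts over the divisors of `t` form a triangular system; the proper divisors cancel by
  -- induction.
  induction t using Nat.strong_induction_on with
  | _ t ih =>
  have h1 : (lattice t ∩ P).ncard = (lattice t ∩ Q).ncard := by
    rw [← ehr_eq_ncard P hpos, ← ehr_eq_ncard Q hpos, h]
  rw [ncard_lattice_inter hP hpos, ncard_lattice_inter hQ hpos,
    ← Nat.insert_self_properDivisors hpos.ne', Finset.sum_insert (by simp),
    Finset.sum_insert (by simp)] at h1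
  have h2 : ∑ k ∈ t.properDivisors, ({y | IsRationalPoint y ∧ denominator y = k} ∩ P).ncard =
      ∑ k ∈ t.properDivisors, ({y | IsRationalPoint y ∧ denominator y = k} ∩ Q).ncard :=
    Finset.sum_congr rfl fun k hk => ih k (Nat.mem_properDivisors.1 hk).2
      (Nat.pos_of_mem_properDivisors hk)
  omega

/-! ### Equidecomposability -/

theorem IsCell.exists_isRationalOpenSimplex {d : ℕ} {S : Set Plane} (hS : IsCell d S) :
    ∃ k ≤ 2, IsRationalOpenSimplex k S := by
  rcases hS with ⟨p, hp, rfl⟩ | ⟨E, ⟨p, q, hpq, rfl, hL⟩, rfl⟩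
  · refine ⟨0, by norm_num, fun _ => p, ?_, fun _ => isRationalPoint_of_mem_lattice hp,
      (openSimplex_zero fun _ => p).symm⟩
    exact affineIndependent_of_subsingleton ℝ (fun _ : Fin 1 => p)
  · have hp : p ∈ segment ℝ p q ∩ lattice d := hL ▸ Or.inl rfl
    have hq : q ∈ segment ℝ p q ∩ lattice d := hL ▸ Or.inr rfl
    refine ⟨1, by norm_num, ![p, q], affineIndependent_of_ne ℝ hpq, fun i => ?_, ?_⟩
    · fin_cases i
      · exact isRationalPoint_of_mem_lattice hp.2
      · exact isRationalPoint_of_mem_lattice hq.2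
    · rw [openSimplex_one]
      show segment ℝ p q \ lattice d = openSegment ℝ p q
      ext y
      constructor
      · rintro ⟨hy, hyL⟩
        refine mem_openSegment_of_ne_left_right ?_ ?_ hy
        · rintro rfl; exact hyL hp.2
        · rintro rfl; exact hyL hq.2
      · intro hy
        have hys := openSegment_subset_segment ℝ p q hy
        refine ⟨hys, fun hyL => ?_⟩
        have h1 : y ∈ ({p, q} : Set Plane) := hL ▸ ⟨hys, hyL⟩
        rcases h1 with rfl | rfl
        · exact hpq (left_mem_openSegment_iff.1 hy)
        · exact hpq (right_mem_openSegment_iff.1 hy)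

theorem IsPolygon.nonempty {P : Set Plane} (hP : IsPolygon P) : P.Nonempty := by
  obtain ⟨n, t, hn, -, rfl⟩ := hP
  exact ⟨t ⟨0, hn⟩ 0, Set.mem_iUnion.2 ⟨⟨0, hn⟩, subset_convexHull ℝ _ ⟨0, rfl⟩⟩⟩

/-! ### Necessity and sufficiency through orbit counts. -/

section

variable {T T' : Set (Set Plane)} {P Q : Set Plane} {f : Plane → Plane}

theorem IsTriangulation.finite_gOrbit_inter (hT : IsTriangulation T P) {x : Plane}
    (hx : IsGeneric x) : (gOrbit x ∩ (P \ ⋃₀ facets T)).Finite := by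
  obtain ⟨N, hN, h⟩ := hT.exists_isCellDecomposition
  obtain ⟨B, hB, hcell, -, hU⟩ := h 1 one_pos
  rw [← hU, Set.sUnion_eq_biUnion, Set.inter_iUnion₂]
  exact hB.biUnion fun S hS => (hcell S hS).finite_gOrbit_inter (by positivity) hx

/-- A facet map relates the generic points on the boundaries to those outside the open facets. -/
theorem IsFacetMap.ncard_frontier_add (hf : IsFacetMap T T' f) (hT : IsTriangulation T P)
    (hT' : IsTriangulation T' Q) (hP : IsPolygon P) (hQ : IsPolygon Q) {x : Plane}
    (hx : IsGeneric x) :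
    (gOrbit x ∩ frontier P).ncard + 2 * (gOrbit x ∩ (Q \ ⋃₀ facets T')).ncard =
      (gOrbit x ∩ frontier Q).ncard + 2 * (gOrbit x ∩ (P \ ⋃₀ facets T)).ncard := by
  have hgen : ∀ y ∈ gOrbit x, IsGeneric y := isGInvariant_isGeneric.gOrbit_subset hx
  have h1 := hT.sum_ncard_frontier hP hgen (hT.finite_gOrbit_inter hx)
  have h2 := hT'.sum_ncard_frontier hQ hgen (hT'.finite_gOrbit_inter hx)
  have h3 : ∑ᶠ S ∈ facets T, (gOrbit x ∩ frontier S).ncard =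
      ∑ᶠ S ∈ facets T', (gOrbit x ∩ frontier S).ncard :=
    finsum_mem_eq_of_bijOn _ hf.bijOn fun S hS =>
      (((hf.isPiecewiseGMap hT'.disjoint).gEquivalent hS).frontier.ncard_inter
        (isGInvariant_gOrbit x)).symm
  omega

theorem IsFacetMap.ncard_sUnion_facets (hf : IsFacetMap T T' f) (hT' : IsTriangulation T' Q)
    {A : Set Plane} (hA : IsGInvariant A) :
    (A ∩ ⋃₀ facets T').ncard = (A ∩ ⋃₀ facets T).ncard := by
  rw [← hf.biUnion_image]
  exact (hf.isPiecewiseGMap hT'.disjoint).ncard_inter hA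

theorem IsEquidecomposabilityRelation.ehr_eq {F : Plane → Plane}
    (hF : IsEquidecomposabilityRelation P Q F) (hP : P.Nonempty) (hQ : Q.Nonempty) :
    ehr P = ehr Q := by
  obtain ⟨T, hT, hg, hdisj, hU⟩ := hF
  funext t
  rcases Nat.eq_zero_or_pos t with rfl | ht
  -- At `t = 0` the dilate is the origin; only here is nonemptiness used.
  · simp [ehr, Set.zero_smul_set hP, Set.zero_smul_set hQ]
  · rw [ehr_eq_ncard P ht, ehr_eq_ncard Q ht, ← hU, ← hT.union]
    exact (IsPiecewiseGMap.ncard_inter ⟨hg, hdisj⟩ (isGInvariant_lattice ht)).symm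

/-- The images of the simplices triangulate `Q`, which makes `F` a facet map. It also preserves
orbit counts off the open facets, so the double count leaves only the boundary terms. -/
theorem IsEquidecomposabilityRelation.ncard_frontier_eq {F : Plane → Plane}
    (hF : IsEquidecomposabilityRelation P Q F) (hP : IsPolygon P) (hQ : IsPolygon Q) {x : Plane}
    (hx : IsGeneric x) : (gOrbit x ∩ frontier P).ncard = (gOrbit x ∩ frontier Q).ncard := by
  obtain ⟨T, hT, hg, hdisj, hU⟩ := hF
  have hpw : IsPiecewiseGMap T F := ⟨hg, hdisj⟩
  have hinj : Set.InjOn (fun S => F '' S) T := by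
    intro S hS S' hS' h
    by_contra hne
    obtain ⟨k, -, hk⟩ := hT.simplex S hS
    obtain ⟨y, hy⟩ := hk.nonempty.image F
    refine Set.disjoint_left.1 (hdisj hS hS' hne) hy ?_
    have h' : F '' S = F '' S' := h
    show y ∈ F '' S'
    rwa [← h']
  have hT' : IsTriangulation ((fun S => F '' S) '' T) Q := by
    refine ⟨hT.finite.image _, ?_, ?_, ?_⟩
    · rintro _ ⟨S, hS, rfl⟩
      obtain ⟨k, hk, hS'⟩ := hT.simplex S hS
      exact ⟨k, hk, (hpw.gEquivalent hS).isRationalOpenSimplex hS'⟩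
    · rintro _ ⟨S, hS, rfl⟩ _ ⟨S', hS', rfl⟩ hne
      exact hdisj hS hS' fun h => hne (by rw [h])
    · rw [← hU, Set.sUnion_image]
  have hfac : facets ((fun S => F '' S) '' T) = (fun S => F '' S) '' facets T := by
    ext S'
    constructor
    · rintro ⟨⟨S, hS, rfl⟩, h⟩
      exact ⟨S, ⟨hS, (hpw.gEquivalent hS).symm.isRationalOpenSimplex h⟩, rfl⟩
    · rintro ⟨S, hS, rfl⟩
      exact ⟨⟨S, hS.1, rfl⟩, (hpw.gEquivalent hS.1).isRationalOpenSimplex hS.2⟩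
  have hf : IsFacetMap T ((fun S => F '' S) '' T) F := by
    refine ⟨?_, fun S hS => hg S hS.1⟩
    rw [hfac]
    exact (hinj.mono (facets_subset T)).bijOn_image
  have hR : (gOrbit x ∩ (Q \ ⋃₀ facets ((fun S => F '' S) '' T))).ncard =
      (gOrbit x ∩ (P \ ⋃₀ facets T)).ncard := by
    rw [← hT.sUnion_diff (facets_subset T), ← hT'.sUnion_diff (facets_subset _), hfac,
      ← hinj.image_sdiff_subset (facets_subset T), Set.sUnion_image]
    exact (hpw.mono Set.sdiff_subset).ncard_inter (isGInvariant_gOrbit x)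
  have := hf.ncard_frontier_add hT hT' hP hQ hx
  omega

theorem IsTriangulation.facets_union (hT : IsTriangulation T P) {N : ℕ} {B : Set (Set Plane)}
    (hB : IsCellDecomposition N B (P \ ⋃₀ facets T)) : IsTriangulation (facets T ∪ B) P := by
  obtain ⟨hfin, hcell, hdisj, hU⟩ := hB
  refine ⟨(hT.finite.subset (facets_subset T)).union hfin, ?_, ?_, ?_⟩
  · rintro S (hS | hS)
    · exact hT.simplex S hS.1
    · exact (hcell S hS).exists_isRationalOpenSimplex
  · refine Set.pairwiseDisjoint_union.2 ⟨hT.disjoint.subset (facets_subset T), hdisj, ?_⟩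
    intro S hS S' hS' _
    refine Set.disjoint_left.2 fun x hx hx' => ?_
    have h1 : x ∈ ⋃₀ B := ⟨S', hS', hx'⟩
    rw [hU] at h1
    exact h1.2 ⟨S, hS, hx⟩
  · rw [Set.sUnion_union, hU, Set.union_sdiff_cancel]
    exact Set.sUnion_subset fun S hS => hT.subset hS.1

theorem IsCellDecomposition.disjoint_facets {N : ℕ} {B : Set (Set Plane)}
    (hB : IsCellDecomposition N B (P \ ⋃₀ facets T)) : Disjoint (facets T) B := by
  refine Set.disjoint_left.2 fun S hS hS' => ?_
  obtain ⟨x, hx⟩ := hS.2.nonempty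
  have h1 : x ∈ ⋃₀ B := ⟨S, hS', hx⟩
  rw [hB.2.2.2] at h1
  exact h1.2 ⟨S, hS, hx⟩

/-- If the complements of the open facets contain equally many points of every orbit, then a facet
map extends to an equidecomposability relation. -/
theorem IsFacetMap.exists_extension (hf : IsFacetMap T T' f) (hT : IsTriangulation T P)
    (hT' : IsTriangulation T' Q)
    (hfin : ∀ x, IsGeneric x ∨ IsRationalPoint x → (gOrbit x ∩ (P \ ⋃₀ facets T)).Finite)
    (hfin' : ∀ x, IsGeneric x ∨ IsRationalPoint x → (gOrbit x ∩ (Q \ ⋃₀ facets T')).Finite)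
    (h : ∀ x, IsGeneric x ∨ IsRationalPoint x → (gOrbit x ∩ (P \ ⋃₀ facets T)).ncard =
      (gOrbit x ∩ (Q \ ⋃₀ facets T')).ncard) :
    ∃ F, IsEquidecomposabilityRelation P Q F ∧ Set.EqOn F f (⋃₀ facets T) := by
  classical
  obtain ⟨N, hN, h1⟩ := hT.exists_isCellDecomposition
  obtain ⟨N', hN', h2⟩ := hT'.exists_isCellDecomposition
  -- Both complements are cut into cells of the same lattice `𝓛_{N N'}`, so that cells of one can be
  -- equivalent to cells of the other.
  obtain ⟨B, hB⟩ := h1 N' hN'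
  obtain ⟨B', hB'⟩ := h2 N hN
  rw [mul_comm] at hB'
  have hd : 0 < N * N' := Nat.mul_pos hN hN'
  have hmap : hB.1.toFinset.val.map gClass = hB'.1.toFinset.val.map gClass := by
    have hcell : ∀ S, S ∈ hB.1.toFinset ∨ S ∈ hB'.1.toFinset → IsCell (N * N') S := by
      intro S hS
      rw [Set.Finite.mem_toFinset, Set.Finite.mem_toFinset] at hS
      exact hS.elim (hB.2.1 S) (hB'.2.1 S)
    refine map_gClass_eq_map_gClass fun S hS => ?_
    obtain ⟨x, hxS, hx, hfinS, honly⟩ := (hcell S hS).exists_point hd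
    refine ⟨gOrbit x, isGInvariant_gOrbit x, hfinS, ⟨x, mem_gOrbit_self x, hxS⟩,
      fun S' hS' => honly S' (hcell S' hS'), ?_⟩
    have hsum : ∀ {B : Set (Set Plane)} {R : Set Plane} (hB : IsCellDecomposition (N * N') B R),
        (gOrbit x ∩ R).Finite →
        (gOrbit x ∩ R).ncard = ∑ S ∈ hB.1.toFinset, (gOrbit x ∩ S).ncard := by
      rintro B _ ⟨hBf, -, hdisj, rfl⟩ hR
      refine ncard_inter_sUnion hBf (fun S hS => hR.subset ?_) fun S hS S' hS' hne => ?_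
      · exact Set.inter_subset_inter_right _ (Set.subset_sUnion_of_mem hS)
      · exact (hdisj hS hS' hne).mono Set.inter_subset_right Set.inter_subset_right
    rw [← hsum hB (hfin x hx), ← hsum hB' (hfin' x hx), h x hx]
  obtain ⟨φ, hφ, hφc⟩ := exists_bijOn_of_map_eq hmap
  rw [Set.Finite.coe_toFinset, Set.Finite.coe_toFinset] at hφ
  -- Facets follow the given facet map, cells follow the matching.
  let Φ : Set Plane → Set Plane := fun S => if S ∈ facets T then f '' S else φ S
  have hΦ₁ : ∀ S ∈ facets T, Φ S = f '' S := fun S hS => if_pos hS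
  have hΦ₂ : ∀ S ∈ B, Φ S = φ S := fun S hS =>
    if_neg fun h => Set.disjoint_left.1 hB.disjoint_facets h hS
  have hb₁ : Set.BijOn Φ (facets T) (facets T') := hf.bijOn.congr fun S hS => (hΦ₁ S hS).symm
  have hb₂ : Set.BijOn Φ B B' := hφ.congr fun S hS => (hΦ₂ S hS).symm
  have hb : Set.BijOn Φ (facets T ∪ B) (facets T' ∪ B') := by
    refine hb₁.union hb₂ ((Set.injOn_union hB.disjoint_facets).2
      ⟨hb₁.injOn, hb₂.injOn, fun S hS S' hS' he => ?_⟩)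
    exact Set.disjoint_left.1 hB'.disjoint_facets (hb₁.mapsTo hS) (he ▸ hb₂.mapsTo hS')
  have hg : ∀ S ∈ facets T ∪ B, ∃ g, IsGMap g ∧ g '' S = Φ S ∧
      (S ∈ facets T → Set.EqOn f g S) := by
    rintro S (hS | hS)
    · obtain ⟨g, hg, he⟩ := hf.gMap S hS
      exact ⟨g, hg, by rw [hΦ₁ S hS, he.image_eq], fun _ => he⟩
    · obtain ⟨g, hg, he⟩ := gClass_eq_iff.1 (hφc S (hB.1.mem_toFinset.2 hS)).symm
      exact ⟨g, hg, by rw [hΦ₂ S hS, he],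
        fun h => absurd hS (Set.disjoint_left.1 hB.disjoint_facets h)⟩
  choose! g hg1 hg2 hg3 using hg
  obtain ⟨F, hF, hFg⟩ := exists_isEquidecomposabilityRelation (hT.facets_union hB)
    (hT'.facets_union hB') hb hg1 hg2
  refine ⟨F, hF, ?_⟩
  rintro x ⟨S, hS, hx⟩
  rw [hFg S (Or.inl hS) hx, hg3 S (Or.inl hS) hS hx]

/-- Rational orbits are finite in `P` and `Q`, so the facet counts can be subtracted. For generic
orbits, which the Ehrhart function does not see, the boundary formula replaces the subtraction. -/
theorem IsFacetMap.exists_extension_of_ehr_eq (hf : IsFacetMap T T' f) (hT : IsTriangulation T P)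
    (hT' : IsTriangulation T' Q) (hP : IsPolygon P) (hQ : IsPolygon Q) (hehr : ehr P = ehr Q)
    (hfr : ∀ x, IsGeneric x → (gOrbit x ∩ frontier P).ncard = (gOrbit x ∩ frontier Q).ncard) :
    ∃ F, IsEquidecomposabilityRelation P Q F ∧ Set.EqOn F f (⋃₀ facets T) := by
  have hfinr : ∀ {x : Plane}, IsRationalPoint x → ∀ {K : Set Plane}, IsCompact K →
      (gOrbit x ∩ K).Finite := by
    intro x hx K hK
    obtain ⟨N, hN, hxN⟩ := hx.exists_mem_lattice
    refine (finite_lattice_inter hN hK).subset ?_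
    rw [Set.inter_comm]
    exact Set.inter_subset_inter_right _ ((isGInvariant_lattice hN).gOrbit_subset hxN)
  refine hf.exists_extension hT hT' ?_ ?_ ?_
  · rintro x (hx | hx)
    · exact hT.finite_gOrbit_inter hx
    · exact (hfinr hx hP.isCompact).subset (Set.inter_subset_inter_right _ Set.sdiff_subset)
  · rintro x (hx | hx)
    · exact hT'.finite_gOrbit_inter hx
    · exact (hfinr hx hQ.isCompact).subset (Set.inter_subset_inter_right _ Set.sdiff_subset)
  · rintro x (hx | hx)
    · have := hf.ncard_frontier_add hT hT' hP hQ hx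
      rw [hfr x hx] at this
      omega
    · have key : ∀ {T : Set (Set Plane)} {P : Set Plane}, IsTriangulation T P → IsPolygon P →
          (gOrbit x ∩ (P \ ⋃₀ facets T)).ncard + (gOrbit x ∩ ⋃₀ facets T).ncard =
            (gOrbit x ∩ P).ncard := by
        intro T P hT hP
        have hsub : ⋃₀ facets T ⊆ P := Set.sUnion_subset fun S hS => hT.subset hS.1
        have hfin := hfinr hx hP.isCompact
        rw [← Set.ncard_union_eq (Set.disjoint_sdiff_left.mono Set.inter_subset_right
          Set.inter_subset_right) (hfin.subset (Set.inter_subset_inter_right _ Set.sdiff_subset))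
          (hfin.subset (Set.inter_subset_inter_right _ hsub)), ← Set.inter_union_distrib_left,
          Set.sdiff_union_of_subset hsub]
      have h1 := key hT hP
      have h2 := key hT' hQ
      have h3 := hf.ncard_sUnion_facets hT' (isGInvariant_gOrbit x)
      have h4 := ncard_gOrbit_inter_eq_of_ehr_eq hP.isCompact hQ.isCompact hehr hx
      omega

end

end DiscreteEquidecomposability

end

open DiscreteEquidecomposability
theorem mainTheorem2 (d : ℕ) (P Q : Set Plane) (hP : IsPolygon P) (hQ : IsPolygon Q)
    (hPd : HasDenominator P d) (hQd : HasDenominator Q d)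
    (T₁ T₂ : Set (Set Plane)) (hT₁ : IsTriangulation T₁ P) (hT₂ : IsTriangulation T₂ Q)
    (f : Plane → Plane) (hf : IsFacetMap T₁ T₂ f) :
    ((∃ F, IsEquidecomposabilityRelation P Q F) ↔
      ehr P = ehr Q ∧ polygonWeight d P = polygonWeight d Q) ∧
    ((∃ F, IsEquidecomposabilityRelation P Q F ∧ Set.EqOn F f (⋃₀ facets T₁)) ↔
      ehr P = ehr Q ∧ polygonWeight d P = polygonWeight d Q) := by
  have hnec : ∀ F, IsEquidecomposabilityRelation P Q F →
      ehr P = ehr Q ∧ polygonWeight d P = polygonWeight d Q := fun F hF =>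
    ⟨hF.ehr_eq hP.nonempty hQ.nonempty, (polygonWeight_eq_iff hP hQ hPd hQd).2
      fun x hx => hF.ncard_frontier_eq hP hQ hx⟩
  have hsuf : ehr P = ehr Q ∧ polygonWeight d P = polygonWeight d Q →
      ∃ F, IsEquidecomposabilityRelation P Q F ∧ Set.EqOn F f (⋃₀ facets T₁) := fun h =>
    hf.exists_extension_of_ehr_eq hT₁ hT₂ hP hQ h.1
      ((polygonWeight_eq_iff hP hQ hPd hQd).1 h.2)
  -- Sufficiency always produces an extension of `f`, so it serves both equivalences.
  refine ⟨⟨fun ⟨F, hF⟩ => hnec F hF, fun h => ?_⟩, fun ⟨F, hF, _⟩ => hnec F hF, hsuf⟩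
  obtain ⟨F, hF, -⟩ := hsuf h
  exact ⟨F, hF⟩
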